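/- Proposition (time-inhomogeneous switching processes). Let $\lambda:\mathbb R_+\times\mathbb R^d\to\mathbb R_+$ be bounded and measurable and let $Q(s,x;dz)$ be a transition probability from $\mathbb R_+\times\mathbb R^d$ to $\mathbb R^d$. Let the intrinsic process $\zeta$ be given by the laws, measurable in $(s,x)\in\mathbb R_+\times\mathbb R^d$, of càdlàg $\mathbb R^d$-valued processes $\zeta^{s,x}=(\zeta^{s,x}(t))_{t\ge0}$ with $\zeta^{s,x}(0)=x$ a.s.; here $\zeta^{s,x}$ has the law of $\zeta(s+\cdot)$ given $\zeta(s)=x$ (no further relation between these laws is needed). For a path $\omega$ started at time $s$ put $$M_s(\omega;dz,dv)=\lambda(s+v,\omega(v))\,e^{-\int_0^v\lambda(s+w,\omega(w))\,dw}\,Q(s+v,\omega(v);dz)\,dv .$$ Let $X=(X_t)_{t\ge0}$ be an associated switching process: there are càdlàg processes $\zeta^{(n)}$ $(n\ge1)$, points $Y_n$ and times $T_n$ $(n\ge0)$ in $\mathbb R_+$, with $T_0=0\le T_1\le T_2\le\cdots$, defined on the same probability space as $X$, such that for every $n\ge0$: - given $\zeta^{(1)},\dots,\zeta^{(n)},Y_0,T_0,\dots,Y_n=z,T_n=s$,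 the process $\zeta^{(n+1)}$ has the law of $\zeta^{s,z}$; - given $\zeta^{(1)},\dots,\zeta^{(n+1)},Y_0,T_0,\dots,Y_n,T_n=s$, the pair $(Y_{n+1},T_{n+1}-T_n)$ has the law $M_s(\zeta^{(n+1)};dz,dv)$ (so that, in particular, this measure a.s. has total mass $1$); - a.s., $X_t=\zeta^{(n+1)}(t-T_n)$ for $T_n\le t<T_{n+1}$, and $X_{T_{n+1}}=Y_{n+1}$. The initial state $Y_0$ is deterministic or random, with an arbitrary law. Let $(\mathcal D(\mathcal A_0),\mathcal A_0)$ be an operator sending each $g$ in a set $\mathcal D(\mathcal A_0)$ of functions to a function $\mathcal A_0g$, where $g$ and $\mathcal A_0g$ are measurable real functions on $\mathbb R_+\times\mathbb R^d$ that are bounded on $[0,t]\times\mathbb R^d$ for every $t$. Suppose that for every $g\in\mathcal D(\mathcal A_0)$ and every $(s,x)\in\mathbb R_+\times\mathbb R^d$ $$g(s+t,\zeta^{s,x}(t))=g(s,\zeta^{s,x}(0))+\int_0^t\mathcal A_0g(s+v,\zeta^{s,x}(v))\,dv+M^{g,s,x}_t,\qquad t\ge0,$$ where $M^{g,s,x}$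 is a martingale in the natural filtration of $\zeta^{s,x}$. Then for every $g\in\mathcal D(\mathcal A_0)$ and $t\ge0$ all the expectations and integrals below exist, and $$\mathbb E\,g(t,X_t)=\mathbb E\,g(0,X_0)+\int_0^t\mathbb E\,\tilde{\mathcal A}_0g(s,X_s)\,ds,$$ $$\tilde{\mathcal A}_0g(s,x)=\mathcal A_0g(s,x)+\lambda(s,x)\int_{\mathbb R^d}\bigl(g(s,z)-g(s,x)\bigr)\,Q(s,x;dz).$$ -/

import Mathlib

open MeasureTheory ProbabilityTheory Filter Topology
open scoped NNReal ENNReal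

noncomputable section

namespace Switching

/-- The state space `ℝ^d`. -/
abbrev State (d : ℕ) : Type := EuclideanSpace ℝ (Fin d)

/-- Càdlàg functions on `[0, ∞)`: right-continuous with left limits. -/
def IsCadlag {d : ℕ} (f : ℝ≥0 → State d) : Prop :=
  ∀ t, ContinuousWithinAt f (Set.Ici t) t ∧ ∃ l, Tendsto f (𝓝[<] t) (𝓝 l)

/-- The space of càdlàg paths `[0, ∞) → ℝ^d`. -/
def Path (d : ℕ) : Type := {f : ℝ≥0 → State d // IsCadlag f}

instance (d : ℕ) : CoeFun (Path d) (fun _ => ℝ≥0 → State d) := ⟨Subtype.val⟩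

/-- The σ-algebra on path space generated by the coordinate maps `ω ↦ ω t`. -/
instance (d : ℕ) : MeasurableSpace (Path d) :=
  inferInstanceAs (MeasurableSpace {f : ℝ≥0 → State d // IsCadlag f})

theorem measurable_coord {d : ℕ} (t : ℝ≥0) : Measurable (fun ω : Path d => ω t) :=
  (measurable_pi_apply t).comp measurable_subtype_coe

/-- The filtration `𝓕_t = σ(ω u, u ≤ t)` on path space. -/
def pathFiltration (d : ℕ) : Filtration ℝ≥0 (inferInstance : MeasurableSpace (Path d)) :=
  Filtration.natural (fun t (ω : Path d) => ω t)
    (fun t => (measurable_coord t).stronglyMeasurable)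

/-- Evaluation `(ω, v) ↦ ω v` is jointly measurable. -/
theorem measurable_eval {d : ℕ} : Measurable (fun p : Path d × ℝ≥0 => p.1 p.2) := by
  have hm : ∀ n : ℕ, Measurable (fun p : Path d × ℝ≥0 =>
      p.1 (((⌊((n : ℝ≥0) + 1) * p.2⌋₊ : ℝ≥0) + 1) / ((n : ℝ≥0) + 1))) := by
    intro n
    have h1 : Measurable (fun q : Path d × ℕ => q.1 (((q.2 : ℝ≥0) + 1) / ((n : ℝ≥0) + 1))) :=
      measurable_from_prod_countable_left fun k =>
        measurable_coord (((k : ℝ≥0) + 1) / ((n : ℝ≥0) + 1))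
    have h2 : Measurable (fun p : Path d × ℝ≥0 => (p.1, ⌊((n : ℝ≥0) + 1) * p.2⌋₊)) :=
      measurable_fst.prodMk (Nat.measurable_floor.comp (measurable_snd.const_mul _))
    exact h1.comp h2
  refine measurable_of_tendsto_metrizable hm (tendsto_pi_nhds.2 fun p => ?_)
  obtain ⟨ω, v⟩ := p
  have hc : Tendsto (fun u => ω u) (𝓝[≥] v) (𝓝 (ω v)) := (ω.2 v).1
  refine hc.comp (tendsto_nhdsWithin_iff.2 ⟨?_, Eventually.of_forall fun n => ?_⟩)
  · have hup : Tendsto (fun n : ℕ => v + 1 / ((n : ℝ≥0) + 1)) atTop (𝓝 v) := by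
      have := (tendsto_const_nhds (x := v)).add
        (NNReal.tendsto_coe.1 (by
          simpa using tendsto_one_div_add_atTop_nhds_zero_nat (𝕜 := ℝ)) :
          Tendsto (fun n : ℕ => 1 / ((n : ℝ≥0) + 1)) atTop (𝓝 0))
      simpa using this
    refine tendsto_of_tendsto_of_tendsto_of_le_of_le tendsto_const_nhds hup
      (fun n => ?_) (fun n => ?_)
    · have hn : (0 : ℝ≥0) < (n : ℝ≥0) + 1 := by positivity
      change v ≤ _
      rw [le_div_iff₀ hn, mul_comm]
      exact (Nat.lt_floor_add_one _).le
    · have hn : (0 : ℝ≥0) < (n : ℝ≥0) + 1 := by positivity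
      change _ ≤ v + 1 / ((n : ℝ≥0) + 1)
      rw [div_le_iff₀ hn, add_mul v, div_mul_cancel₀ _ hn.ne', mul_comm v]
      gcongr
      exact Nat.floor_le zero_le
  · have hn : (0 : ℝ≥0) < (n : ℝ≥0) + 1 := by positivity
    change v ≤ _
    rw [le_div_iff₀ hn, mul_comm]
    exact (Nat.lt_floor_add_one _).le

/-- Lebesgue measure on the time half-line `[0, ∞)`. -/
def timeMeasure : Measure ℝ≥0 := (volume : Measure ℝ).comap ((↑) : ℝ≥0 → ℝ)

theorem timeMeasure_Iic (t : ℝ≥0) : timeMeasure (Set.Iic t) = t := by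
  have he : MeasurableEmbedding ((↑) : ℝ≥0 → ℝ) :=
    MeasurableEmbedding.subtype_coe measurableSet_Ici
  rw [timeMeasure, he.comap_apply]
  have : ((↑) : ℝ≥0 → ℝ) '' Set.Iic t = Set.Icc 0 (t : ℝ) := by
    ext x
    constructor
    · rintro ⟨y, hy, rfl⟩
      exact ⟨y.2, NNReal.coe_le_coe.2 hy⟩
    · rintro ⟨h0, h1⟩
      exact ⟨⟨x, h0⟩, h1, rfl⟩
  rw [this]
  simp

instance : SigmaFinite timeMeasure :=
  ⟨⟨{ set := fun n => Set.Iic (n : ℝ≥0)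
      set_mem := fun _ => trivial
      finite := fun n => by simp [timeMeasure_Iic]
      spanning := Set.eq_univ_of_forall fun x => Set.mem_iUnion.2 (exists_nat_ge x) }⟩⟩

/-- For a path `ω` started at time `s`, so that `ω v` is the position at time `s + v`, the density
`λ(s+v, ω v) exp (- ∫_0^v λ(s+w, ω w) dw)` of the time elapsed until the next switching. -/
def switchDensity {d : ℕ} (lam : ℝ≥0 × State d → ℝ≥0) (p : ℝ≥0 × Path d) (v : ℝ≥0) : ℝ≥0∞ :=
  (lam (p.1 + v, p.2 v) : ℝ≥0∞) *
    ENNReal.ofReal (Real.exp (-∫ w in Set.Iic v, (lam (p.1 + w, p.2 w) : ℝ) ∂timeMeasure))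

theorem measurable_timeSpace {d : ℕ} : Measurable
    (fun q : (ℝ≥0 × Path d) × ℝ≥0 => ((q.1.1 + q.2, q.1.2 q.2) : ℝ≥0 × State d)) :=
  (measurable_fst.fst.add measurable_snd).prodMk
    (measurable_eval.comp (measurable_fst.snd.prodMk measurable_snd))

theorem measurable_switchDensity {d : ℕ} {lam : ℝ≥0 × State d → ℝ≥0} (hlam : Measurable lam) :
    Measurable (Function.uncurry (switchDensity lam)) := by
  have h1 : Measurable (fun q : (ℝ≥0 × Path d) × ℝ≥0 => lam (q.1.1 + q.2, q.1.2 q.2)) :=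
    hlam.comp measurable_timeSpace
  have h2 : Measurable (fun q : (ℝ≥0 × Path d) × ℝ≥0 =>
      ∫ w in Set.Iic q.2, (lam (q.1.1 + w, q.1.2 w) : ℝ) ∂timeMeasure) := by
    have h3 : Measurable (fun r : ((ℝ≥0 × Path d) × ℝ≥0) × ℝ≥0 =>
        (lam (r.1.1.1 + r.2, r.1.1.2 r.2) : ℝ)) :=
      (h1.comp (measurable_fst.fst.prodMk measurable_snd)).coe_nnreal_real
    have hs : MeasurableSet {r : ((ℝ≥0 × Path d) × ℝ≥0) × ℝ≥0 | r.2 ≤ r.1.2} :=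
      measurableSet_le measurable_snd measurable_fst.snd
    have h4 := ((h3.indicator hs).stronglyMeasurable.integral_prod_right'
      (ν := timeMeasure)).measurable
    refine (congrArg Measurable (funext fun q => ?_)).mp h4
    rw [← integral_indicator measurableSet_Iic]
    rfl
  exact h1.coe_nnreal_ennreal.mul (Real.measurable_exp.comp h2.neg).ennreal_ofReal

/-- The switching kernel: for a path `ω` started at time `s`, the measure
`M_s(ω; dz, dv) = λ(s+v, ω v) exp (- ∫_0^v λ(s+w, ω w) dw) Q(s+v, ω v; dz) dv`
of the pair (new position, elapsed time). -/
def switchKernel {d : ℕ} (lam : ℝ≥0 × State d → ℝ≥0) (Q : Kernel (ℝ≥0 × State d) (State d)) :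
    Kernel (ℝ≥0 × Path d) (State d × ℝ≥0) :=
  (Kernel.withDensity (Kernel.const (ℝ≥0 × Path d) timeMeasure) (switchDensity lam) ⊗ₖ
    Q.comap (fun q : (ℝ≥0 × Path d) × ℝ≥0 => ((q.1.1 + q.2, q.1.2 q.2) : ℝ≥0 × State d))
      measurable_timeSpace).map Prod.swap

instance {d : ℕ} (lam : ℝ≥0 × State d → ℝ≥0) :
    IsSFiniteKernel (Kernel.withDensity (Kernel.const (ℝ≥0 × Path d) timeMeasure)
      (switchDensity lam)) :=
  Kernel.IsSFiniteKernel.withDensity _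
    fun _ _ => ENNReal.mul_ne_top ENNReal.coe_ne_top ENNReal.ofReal_ne_top

instance {d : ℕ} (lam : ℝ≥0 × State d → ℝ≥0) (Q : Kernel (ℝ≥0 × State d) (State d)) :
    IsSFiniteKernel (switchKernel lam Q) := by
  unfold switchKernel
  infer_instance

/-- The kernel `switchKernel` is the measure `M_s(ω; dz, dv)` displayed in its description. -/
theorem lintegral_switchKernel {d : ℕ} {lam : ℝ≥0 × State d → ℝ≥0} (hlam : Measurable lam)
    (Q : Kernel (ℝ≥0 × State d) (State d)) [IsMarkovKernel Q] (s : ℝ≥0) (ω : Path d)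
    {φ : State d × ℝ≥0 → ℝ≥0∞} (hφ : Measurable φ) :
    ∫⁻ y, φ y ∂(switchKernel lam Q (s, ω)) =
      ∫⁻ v, (lam (s + v, ω v) : ℝ≥0∞) *
        ENNReal.ofReal (Real.exp (-∫ w in Set.Iic v, (lam (s + w, ω w) : ℝ) ∂timeMeasure)) *
        ∫⁻ z, φ (z, v) ∂(Q (s + v, ω v)) ∂timeMeasure := by
  have hφ' : Measurable (fun q : ℝ≥0 × State d => φ q.swap) := hφ.comp measurable_swap
  rw [switchKernel, Kernel.lintegral_map _ measurable_swap _ hφ,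
    Kernel.lintegral_compProd _ _ _ hφ',
    Kernel.lintegral_withDensity _ (measurable_switchDensity hlam)]
  · rfl
  · exact hφ'.lintegral_kernel_prod_right'
      (κ := (Q.comap (fun q : (ℝ≥0 × Path d) × ℝ≥0 =>
        ((q.1.1 + q.2, q.1.2 q.2) : ℝ≥0 × State d)) measurable_timeSpace).comap
          (fun v => ((s, ω), v)) measurable_prodMk_left)
      |>.comp measurable_id

/-- The variables known just before the path `ζ_n` is drawn: `ζ_0, …, ζ_{n-1}` and
`(Y_0, T_0), …, (Y_n, T_n)`. -/
def historyBefore {d : ℕ} {Ω : Type*} (ζ : ℕ → Ω → Path d) (Y : ℕ → Ω → State d)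
    (T : ℕ → Ω → ℝ≥0) (n : ℕ) (ω : Ω) : (Fin n → Path d) × (Fin (n + 1) → State d × ℝ≥0) :=
  (fun i => ζ i ω, fun i => (Y i ω, T i ω))

/-- The variables known just after the path `ζ_n` is drawn: `ζ_0, …, ζ_n` and
`(Y_0, T_0), …, (Y_n, T_n)`. -/
def historyAfter {d : ℕ} {Ω : Type*} (ζ : ℕ → Ω → Path d) (Y : ℕ → Ω → State d)
    (T : ℕ → Ω → ℝ≥0) (n : ℕ) (ω : Ω) :
    (Fin (n + 1) → Path d) × (Fin (n + 1) → State d × ℝ≥0) :=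
  (fun i => ζ i ω, fun i => (Y i ω, T i ω))

/-- The step-by-step construction of the time-inhomogeneous switching process. The kernel `P`
gives the law `P (s, x)` of the intrinsic path `v ↦ ζ^{s,x} v` that is at `x` at time `s`
(`v` being the time elapsed since `s`). The path `ζ n` is followed between the switching times
`T n` and `T (n+1)`, and `Y n` is the position at time `T n`. -/
structure IsConstruction {d : ℕ} {Ω : Type*} [MeasurableSpace Ω]
    (P : Kernel (ℝ≥0 × State d) (Path d)) (lam : ℝ≥0 × State d → ℝ≥0)
    (Q : Kernel (ℝ≥0 × State d) (State d)) (ζ : ℕ → Ω → Path d) (Y : ℕ → Ω → State d)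
    (T : ℕ → Ω → ℝ≥0) (X : ℝ≥0 → Ω → State d) (μ : Measure Ω) : Prop where
  /-- `T_0 = 0`. -/
  time_zero : ∀ᵐ ω ∂μ, T 0 ω = 0
  /-- The switching times are nondecreasing. -/
  time_mono : ∀ᵐ ω ∂μ, Monotone fun n => T n ω
  /-- Given the past with `Y_n = z` and `T_n = s`, the path `ζ_n` has the law `P (s, z)`. -/
  law_path : ∀ n, HasCondDistrib (ζ n) (historyBefore ζ Y T n)
    (P.comap (fun h : (Fin n → Path d) × (Fin (n + 1) → State d × ℝ≥0) =>
      ((h.2 (Fin.last n)).2, (h.2 (Fin.last n)).1)) (by fun_prop)) μ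
  /-- Given the past with `T_n = s`, the law of `(Y_{n+1}, T_{n+1} - T_n)` is
  `M_s(ζ_n; dz, dv)`. -/
  law_switch : ∀ n, HasCondDistrib (fun ω => (Y (n + 1) ω, T (n + 1) ω - T n ω))
    (historyAfter ζ Y T n)
    ((switchKernel lam Q).comap
      (fun h : (Fin (n + 1) → Path d) × (Fin (n + 1) → State d × ℝ≥0) =>
        ((h.2 (Fin.last n)).2, h.1 (Fin.last n))) (by fun_prop)) μ
  /-- Between two switchings `X` follows the current path. -/
  between : ∀ᵐ ω ∂μ, ∀ n t, T n ω ≤ t → t < T (n + 1) ω → X t ω = ζ n ω (t - T n ω)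
  /-- At a switching time `X` takes the new position. -/
  at_switch : ∀ᵐ ω ∂μ, ∀ n, X (T (n + 1) ω) ω = Y (n + 1) ω

/-- `X` is a time-inhomogeneous switching process associated with the intrinsic laws `P`, the
rate `lam` and the transition kernel `Q`. -/
def IsInhomogeneousSP {d : ℕ} {Ω : Type*} [MeasurableSpace Ω]
    (P : Kernel (ℝ≥0 × State d) (Path d)) (lam : ℝ≥0 × State d → ℝ≥0)
    (Q : Kernel (ℝ≥0 × State d) (State d)) (X : ℝ≥0 → Ω → State d) (μ : Measure Ω) : Prop :=
  ∃ (ζ : ℕ → Ω → Path d) (Y : ℕ → Ω → State d) (T : ℕ → Ω → ℝ≥0),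
    IsConstruction P lam Q ζ Y T X μ

/-- Boundedness on `[0, t] × ℝ^d` for every `t`. -/
def BoundedOnStrips {d : ℕ} (f : ℝ≥0 × State d → ℝ) : Prop :=
  ∀ t : ℝ≥0, ∃ C : ℝ, ∀ s ≤ t, ∀ x, |f (s, x)| ≤ C

/-- The compensated process `M^g` started from time `s`, on path space:
`M^g_t = g(s+t, ω t) - g(s, ω 0) - ∫_0^t a(s+v, ω v) dv`. -/
def compensated {d : ℕ} (g a : ℝ≥0 × State d → ℝ) (s t : ℝ≥0) (ω : Path d) : ℝ :=
  g (s + t, ω t) - g (s, ω 0) - ∫ v in Set.Iic t, a (s + v, ω v) ∂timeMeasure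

/-- `(s, x) ↦ a(s,x) + λ(s,x) ∫ (g(s,z) - g(s,x)) Q(s,x;dz)`. -/
def withSwitching {d : ℕ} (lam : ℝ≥0 × State d → ℝ≥0) (Q : Kernel (ℝ≥0 × State d) (State d))
    (g a : ℝ≥0 × State d → ℝ) (p : ℝ≥0 × State d) : ℝ :=
  a p + lam p * ∫ z, (g (p.1, z) - g p) ∂(Q p)

end Switching

end

namespace Switching

/-! Between switchings the process follows an intrinsic path, for which `g` minus the integral of
`A₀ g` is a martingale `M`. Switchings occur at rate `λ` and contribute the mean jump `λ ∫ (g(z) -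
g) dQ`. The proof makes this exact over one stretch between switchings, then telescopes.

One stretch. Fix a path started at time `s`, let `u` be the time left until `t`, and let `S(v)` be
the probability of no switching up to elapsed time `v`. Consider `g` at the next switching or at
time `u`, whichever comes first, minus the integral of `Ã₀ g` until then. Averaging over the
switching, the `Q`-terms cancel and `S(u) g - ∫ S (A₀ g - λ g)` remains
(`integral_switchKernel_step`). Integration by parts turns this into `g(s, ω 0) + S(u) M_u + ∫ λ S
M_w dw` (`survival_mul_sub_setIntegral`). Since `λ S` is bounded and adapted, `M_w` may be replaced
by `M_u` in expectation. As `∫_0^u λ S = 1 - S(u)`, the martingale terms add up to `M_u`, which has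
mean zero (`integral_survival_mul`). So the mean over one stretch is the value of `g` at its start
(`integral_stepFunctional`).

Telescoping. By the above, the mean of `stoppedFunctional` does not depend on `n`. As `λ` is
bounded, `E exp(-T_n)` decays geometrically, so `T_n → ∞` almost surely (`ae_exists_lt_time`), and
dominated convergence gives the formula for bounded functions. Functions bounded only on strips are
cut off after time `t`. -/

/-! ### Calculus for Lebesgue measure on the half-line. -/

theorem measurableEmbedding_coe_nnreal : MeasurableEmbedding ((↑) : ℝ≥0 → ℝ) :=
  MeasurableEmbedding.subtype_coe measurableSet_Ici

instance : NullSingletonClass timeMeasure :=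
  ⟨fun x => by simp [timeMeasure, measurableEmbedding_coe_nnreal.comap_apply]⟩

instance (t : ℝ≥0) : IsFiniteMeasure (timeMeasure.restrict (Set.Iic t)) :=
  ⟨by simp [timeMeasure_Iic]⟩

theorem map_coe_timeMeasure :
    timeMeasure.map ((↑) : ℝ≥0 → ℝ) = (volume : Measure ℝ).restrict (Set.Ici 0) := by
  rw [timeMeasure, measurableEmbedding_coe_nnreal.map_comap]
  congr 1
  exact Subtype.range_coe

theorem setIntegral_timeMeasure (f : ℝ → ℝ) (t : ℝ≥0) :
    ∫ w in Set.Iic t, f w ∂timeMeasure = ∫ x in (0 : ℝ)..t, f x := by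
  have h := measurableEmbedding_coe_nnreal.setIntegral_map (μ := timeMeasure) f (Set.Iic (t : ℝ))
  rw [map_coe_timeMeasure, Measure.restrict_restrict measurableSet_Iic] at h
  have h1 : ((↑) : ℝ≥0 → ℝ) ⁻¹' Set.Iic (t : ℝ) = Set.Iic t := by ext x; simp
  have h2 : Set.Iic (t : ℝ) ∩ Set.Ici 0 = Set.Icc 0 (t : ℝ) := by ext x; simp [and_comm]
  rw [h1, h2, integral_Icc_eq_integral_Ioc] at h
  rw [intervalIntegral.integral_of_le t.coe_nonneg, ← h]

theorem map_add_timeMeasure (s : ℝ≥0) :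
    timeMeasure.map (fun w => s + w) = timeMeasure.restrict (Set.Ici s) := by
  ext A hA
  rw [Measure.map_apply (measurable_const_add s) hA, Measure.restrict_apply hA, timeMeasure,
    measurableEmbedding_coe_nnreal.comap_apply, measurableEmbedding_coe_nnreal.comap_apply,
    ← measure_preimage_add volume (s : ℝ) (((↑) : ℝ≥0 → ℝ) '' (A ∩ Set.Ici s))]
  congr 1
  ext x
  constructor
  · rintro ⟨w, hw, rfl⟩
    exact ⟨s + w, ⟨hw, by simp⟩, by simp⟩
  · rintro ⟨r, ⟨hr, hs⟩, hx⟩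
    obtain ⟨w, rfl⟩ := exists_add_of_le (show s ≤ r from hs)
    refine ⟨w, hr, ?_⟩
    simpa using hx

theorem measurableEmbedding_add_nnreal (s : ℝ≥0) :
    MeasurableEmbedding (fun w : ℝ≥0 => s + w) := by
  refine Topology.IsClosedEmbedding.measurableEmbedding (Isometry.isClosedEmbedding fun x y => ?_)
  simp [edist_dist, NNReal.dist_eq]

/-- Translation by `s`. Writing the right side over the fixed interval up to `t`, with a cut-off,
lets integrals over successive stretches be subtracted. -/
theorem setIntegral_add_timeMeasure (f : ℝ≥0 → ℝ) {s t : ℝ≥0} (hst : s ≤ t) :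
    ∫ w in Set.Iic (t - s), f (s + w) ∂timeMeasure =
      ∫ r in Set.Iic t, (if s ≤ r then f r else 0) ∂timeMeasure := by
  have h := (measurableEmbedding_add_nnreal s).setIntegral_map (μ := timeMeasure) f (Set.Iic t)
  have h1 : (fun w => s + w) ⁻¹' Set.Iic t = Set.Iic (t - s) := by
    ext w
    simp [le_tsub_iff_left hst]
  rw [h1, map_add_timeMeasure] at h
  rw [← h, Measure.restrict_restrict measurableSet_Iic, ← setIntegral_indicator measurableSet_Ici]
  rfl

theorem integrable_of_bounded {α : Type*} [MeasurableSpace α] {μ : Measure α} [IsFiniteMeasure μ]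
    {f : α → ℝ} (hf : AEStronglyMeasurable f μ) {C : ℝ} (hC : ∀ x, |f x| ≤ C) : Integrable f μ :=
  Integrable.of_bound hf C (Eventually.of_forall hC)

theorem abs_setIntegral_timeMeasure_le {f : ℝ≥0 → ℝ} {C : ℝ} (hC : ∀ x, |f x| ≤ C) (t : ℝ≥0) :
    |∫ w in Set.Iic t, f w ∂timeMeasure| ≤ C * t := by
  have := norm_setIntegral_le_of_norm_le_const (μ := timeMeasure) (s := Set.Iic t) (f := f)
    (C := C) (by simp [timeMeasure_Iic]) fun x _ => hC x
  simpa [Measure.real, timeMeasure_Iic] using this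

theorem measurable_setIntegral_Iic {α : Type*} [MeasurableSpace α] {f : α × ℝ≥0 → ℝ}
    (hf : Measurable f) :
    Measurable fun q : α × ℝ≥0 => ∫ w in Set.Iic q.2, f (q.1, w) ∂timeMeasure := by
  have h1 : Measurable fun r : (α × ℝ≥0) × ℝ≥0 => f (r.1.1, r.2) :=
    hf.comp (measurable_fst.fst.prodMk measurable_snd)
  have hs : MeasurableSet {r : (α × ℝ≥0) × ℝ≥0 | r.2 ≤ r.1.2} :=
    measurableSet_le measurable_snd measurable_fst.snd
  have h4 := ((h1.indicator hs).stronglyMeasurable.integral_prod_right'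
    (ν := timeMeasure)).measurable
  refine (congrArg Measurable (funext fun q => ?_)).mp h4
  rw [← integral_indicator measurableSet_Iic]
  rfl

/-- Fundamental theorem of calculus for the exponential of minus the primitive of a bounded
measurable function. -/
theorem setIntegral_mul_exp_neg {l : ℝ≥0 → ℝ} (hl : Measurable l) (h0 : ∀ w, 0 ≤ l w) {C : ℝ}
    (hC : ∀ w, l w ≤ C) (v : ℝ≥0) :
    ∫ w in Set.Iic v, l w * Real.exp (-∫ r in Set.Iic w, l r ∂timeMeasure) ∂timeMeasure =
      1 - Real.exp (-∫ r in Set.Iic v, l r ∂timeMeasure) := by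
  -- The extension equals `l 0` on negative reals, so the bound `C` holds on the whole line.
  set m : ℝ → ℝ := fun x => l x.toNNReal with hm_def
  have hm : Measurable m := hl.comp measurable_real_toNNReal
  have hmb : ∀ x, ‖m x‖ ≤ C := fun x => by
    rw [Real.norm_of_nonneg (h0 _)]; exact hC _
  have hC0 : 0 ≤ C := (h0 0).trans (hC 0)
  have hloc : LocallyIntegrable m volume :=
    (locallyIntegrable_const C).mono hm.aestronglyMeasurable (Eventually.of_forall fun x =>
      (hmb x).trans (le_abs_self C))
  have hint : ∀ a b, IntervalIntegrable m volume a b := fun a b =>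
    hloc.integrableOn_isCompact isCompact_uIcc |>.intervalIntegrable
  set L : ℝ → ℝ := fun x => ∫ r in (0 : ℝ)..x, m r with hL_def
  have hLl : ∀ w : ℝ≥0, ∫ r in Set.Iic w, l r ∂timeMeasure = L w := fun w => by
    have := setIntegral_timeMeasure m w
    simpa [hm_def] using this
  have hLdiff : ∀ x y, L y - L x = ∫ r in x..y, m r := fun x y =>
    intervalIntegral.integral_interval_sub_left (hint _ _) (hint _ _)
  have hLip : LipschitzWith C.toNNReal L := by
    refine LipschitzWith.of_dist_le_mul fun x y => ?_
    rw [Real.dist_eq, hLdiff, Real.coe_toNNReal _ hC0, Real.dist_eq, ← Real.norm_eq_abs]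
    exact intervalIntegral.norm_integral_le_of_norm_le_const fun r _ => hmb r
  have hL0 : ∀ x, 0 ≤ x → 0 ≤ L x := fun x hx =>
    intervalIntegral.integral_nonneg hx fun r _ => h0 _
  -- As `L` is differentiable only almost everywhere, the fundamental theorem needs absolute
  -- continuity. It follows from a Lipschitz bound: `-L` is nonpositive on `[0, v]`, and `exp` is
  -- 1-Lipschitz there.
  have hexp : LipschitzOnWith 1 Real.exp (Set.Iic 0) := by
    refine (convex_Iic (0 : ℝ)).lipschitzOnWith_of_nnnorm_deriv_le
      (fun x _ => Real.differentiableAt_exp) fun x hx => ?_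
    rw [Real.deriv_exp, ← NNReal.coe_le_coe]
    simpa using hx
  have hF : LipschitzOnWith (1 * C.toNNReal) (fun x => Real.exp (-L x))
      (Set.uIcc 0 (v : ℝ)) := by
    refine hexp.comp (hLip.neg.lipschitzOnWith) fun x hx => ?_
    rw [Set.uIcc_of_le v.coe_nonneg] at hx
    simpa using hL0 x hx.1
  have hFTC := hF.absolutelyContinuousOnInterval.integral_deriv_eq_sub
  have hder : ∀ᵐ x, deriv (fun x => Real.exp (-L x)) x = -(m x * Real.exp (-L x)) := by
    filter_upwards [_root_.LocallyIntegrable.ae_hasDerivAt_integral hloc] with x hx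
    refine (hx 0).neg.exp.deriv.trans ?_
    change Real.exp (-L x) * -m x = _
    ring
  rw [intervalIntegral.integral_congr_ae (hder.mono fun x hx _ => hx),
    intervalIntegral.integral_neg] at hFTC
  have hL00 : L 0 = 0 := by simp [hL_def]
  simp only [hL00, neg_zero, Real.exp_zero] at hFTC
  simp_rw [hLl]
  have := setIntegral_timeMeasure (fun x => m x * Real.exp (-L x)) v
  simp only [hm_def, Real.toNNReal_coe] at this
  rw [this]
  linarith

/-- Fubini on the triangle `v ≤ w ≤ u`; this is the integration by parts used along a path. -/
theorem setIntegral_mul_setIntegral {k a : ℝ≥0 → ℝ} (hk : Measurable k) (ha : Measurable a)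
    {C D : ℝ} (hC : ∀ w, |k w| ≤ C) (hD : ∀ w, |a w| ≤ D) (u : ℝ≥0) :
    ∫ w in Set.Iic u, k w * ∫ v in Set.Iic w, a v ∂timeMeasure ∂timeMeasure =
      ∫ v in Set.Iic u, a v * ((∫ w in Set.Iic u, k w ∂timeMeasure) -
        ∫ w in Set.Iic v, k w ∂timeMeasure) ∂timeMeasure := by
  have hC0 : 0 ≤ C := (abs_nonneg _).trans (hC 0)
  have hD0 : 0 ≤ D := (abs_nonneg _).trans (hD 0)
  have hki : ∀ t, IntegrableOn k (Set.Iic t) timeMeasure := fun t =>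
    integrable_of_bounded hk.aestronglyMeasurable hC
  have hl : ∀ w ∈ Set.Iic u, k w * ∫ v in Set.Iic w, a v ∂timeMeasure =
      ∫ v in Set.Iic u, (if v ≤ w then k w * a v else 0) ∂timeMeasure := fun w hw => by
    have h1 : (fun v => if v ≤ w then k w * a v else 0) =
        (Set.Iic w).indicator fun v => k w * a v := rfl
    rw [h1, setIntegral_indicator measurableSet_Iic,
      Set.inter_eq_right.2 (Set.Iic_subset_Iic.2 hw), integral_const_mul]
  have hr : ∀ v ∈ Set.Iic u, ∫ w in Set.Iic u, (if v ≤ w then k w * a v else 0) ∂timeMeasure =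
      a v * ((∫ w in Set.Iic u, k w ∂timeMeasure) -
        ∫ w in Set.Iic v, k w ∂timeMeasure) := fun v hv => by
    -- The interval `[v, u]` is `[0, u]` minus `[0, v)`, and `[0, v)` may be closed because points
    -- are null.
    have h1 : (fun w => if v ≤ w then k w * a v else 0) =
        fun w => k w * a v - (Set.Iio v).indicator (fun w => k w * a v) w := by
      ext w
      by_cases h : v ≤ w <;> simp [h, Set.indicator, not_lt.2, lt_of_not_ge]
    rw [h1, integral_sub ((hki u).mul_const _)
      (((hki u).mul_const _).indicator measurableSet_Iio), setIntegral_indicator measurableSet_Iio,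
      Set.inter_eq_right.2 ((Set.Iio_subset_Iic_self).trans (Set.Iic_subset_Iic.2 hv)),
      integral_mul_const, integral_mul_const, ← integral_Iic_eq_integral_Iio]
    ring
  rw [setIntegral_congr_fun measurableSet_Iic hl, ← setIntegral_congr_fun measurableSet_Iic hr]
  refine integral_integral_swap (integrable_of_bounded (C := C * D) ?_ fun p => ?_)
  · refine (Measurable.ite ?_ ?_ measurable_const).aestronglyMeasurable
    · exact measurableSet_le measurable_snd measurable_fst
    · exact (hk.comp measurable_fst).mul (ha.comp measurable_snd)
  · simp only [Function.uncurry]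
    split_ifs
    · rw [abs_mul]
      exact mul_le_mul (hC _) (hD _) (abs_nonneg _) hC0
    · simpa using mul_nonneg hC0 hD0

/-! ### The survival probability along a path and its adaptedness. -/

variable {d : ℕ}

theorem measurable_setIntegral_path {a : ℝ≥0 × State d → ℝ} (ha : Measurable a) :
    Measurable (fun q : (ℝ≥0 × Path d) × ℝ≥0 =>
      ∫ w in Set.Iic q.2, a (q.1.1 + w, q.1.2 w) ∂timeMeasure) :=
  measurable_setIntegral_Iic (ha.comp measurable_timeSpace)

/-- The probability that a path started at time `s` has not switched after time `v`. -/
noncomputable def survival (lam : ℝ≥0 × State d → ℝ≥0) (p : ℝ≥0 × Path d) (v : ℝ≥0) : ℝ :=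
  Real.exp (-∫ w in Set.Iic v, (lam (p.1 + w, p.2 w) : ℝ) ∂timeMeasure)

theorem measurable_survival {lam : ℝ≥0 × State d → ℝ≥0} (hlam : Measurable lam) :
    Measurable (fun q : (ℝ≥0 × Path d) × ℝ≥0 => survival lam q.1 q.2) :=
  Real.measurable_exp.comp (measurable_setIntegral_path hlam.coe_nnreal_real).neg

theorem survival_nonneg (lam : ℝ≥0 × State d → ℝ≥0) (p : ℝ≥0 × Path d) (v : ℝ≥0) :
    0 ≤ survival lam p v := (Real.exp_pos _).le

theorem survival_le_one (lam : ℝ≥0 × State d → ℝ≥0) (p : ℝ≥0 × Path d) (v : ℝ≥0) :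
    survival lam p v ≤ 1 :=
  Real.exp_le_one_iff.2 (neg_nonpos.2 (integral_nonneg fun _ => NNReal.coe_nonneg _))

theorem setIntegral_mul_survival {lam : ℝ≥0 × State d → ℝ≥0} (hlam : Measurable lam) {C : ℝ≥0}
    (hC : ∀ p, lam p ≤ C) (p : ℝ≥0 × Path d) (v : ℝ≥0) :
    ∫ w in Set.Iic v, lam (p.1 + w, p.2 w) * survival lam p w ∂timeMeasure =
      1 - survival lam p v :=
  setIntegral_mul_exp_neg (l := fun w => (lam (p.1 + w, p.2 w) : ℝ))
    (hlam.comp (measurable_timeSpace.comp measurable_prodMk_left)).coe_nnreal_real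
    (fun _ => NNReal.coe_nonneg _) (fun _ => NNReal.coe_le_coe.2 (hC _)) v

theorem exp_neg_le_survival {lam : ℝ≥0 × State d → ℝ≥0} {C : ℝ≥0}
    (hC : ∀ p, lam p ≤ C) (p : ℝ≥0 × Path d) (v : ℝ≥0) :
    Real.exp (-(C * v)) ≤ survival lam p v := by
  refine Real.exp_le_exp.2 (neg_le_neg ((le_abs_self _).trans ?_))
  exact abs_setIntegral_timeMeasure_le (C := C) (fun w => by
    rw [NNReal.abs_eq]; exact NNReal.coe_le_coe.2 (hC _)) v

theorem IsCadlag.stopped {f : ℝ≥0 → State d} (hf : IsCadlag f) (w : ℝ≥0) :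
    IsCadlag fun t => f (min t w) := fun t => by
  rcases lt_or_ge t w with h | h
  · have he : (fun t => f (min t w)) =ᶠ[𝓝 t] f :=
      (eventually_lt_nhds h).mono fun r hr => by simp [min_eq_left hr.le]
    obtain ⟨hc, l, hl⟩ := hf t
    exact ⟨hc.congr_of_eventuallyEq (he.filter_mono nhdsWithin_le_nhds) he.self_of_nhds, l,
      hl.congr' ((he.filter_mono nhdsWithin_le_nhds).mono fun r hr => hr.symm)⟩
  · refine ⟨(continuousWithinAt_const (b := f w)).congr (fun r hr => ?_) ?_, ?_⟩
    · simp [min_eq_right (h.trans hr)]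
    · simp [min_eq_right h]
    · rcases h.eq_or_lt with rfl | h
      · obtain ⟨-, l, hl⟩ := hf w
        refine ⟨l, hl.congr' ?_⟩
        filter_upwards [self_mem_nhdsWithin] with r hr
        rw [min_eq_left (le_of_lt (Set.mem_Iio.1 hr))]
      · refine ⟨f w, tendsto_const_nhds.congr' ?_⟩
        filter_upwards [mem_nhdsWithin_of_mem_nhds (lt_mem_nhds h)] with r hr
        rw [min_eq_right (le_of_lt hr)]

/-- The path stopped at time `w`. -/
def stoppedPath (w : ℝ≥0) (ω : Path d) : Path d :=
  ⟨fun t => ω (min t w), ω.2.stopped w⟩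

theorem measurable_coord_pathFiltration {r w : ℝ≥0} (h : r ≤ w) :
    Measurable[pathFiltration d w] (fun ω : Path d => ω r) :=
  ((Filtration.stronglyAdapted_natural
    (fun t => (measurable_coord (d := d) t).stronglyMeasurable) r).measurable).mono
      ((pathFiltration d).mono h) le_rfl

theorem measurable_path {α : Type*} {m : MeasurableSpace α} {f : α → Path d}
    (hf : ∀ t, Measurable fun a => f a t) : Measurable f :=
  Measurable.subtype_mk (measurable_pi_lambda _ hf)

theorem measurable_stoppedPath (w : ℝ≥0) :
    Measurable[pathFiltration d w] (stoppedPath (d := d) w) :=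
  measurable_path (m := pathFiltration d w)
    fun t => measurable_coord_pathFiltration (min_le_right t w)

theorem survival_stoppedPath (lam : ℝ≥0 × State d → ℝ≥0) (s w : ℝ≥0) (ω : Path d) :
    survival lam (s, stoppedPath w ω) w = survival lam (s, ω) w := by
  unfold survival
  congr 2
  refine setIntegral_congr_fun measurableSet_Iic fun r hr => ?_
  have : stoppedPath w ω r = ω r := congrArg ω (min_eq_left hr)
  simp only [this]

/-- Survival up to `w` reads the path only on `[0, w]`, so it factors through `stoppedPath w`, which
is measurable for the σ-algebra at time `w`. -/
theorem measurable_survival_pathFiltration {lam : ℝ≥0 × State d → ℝ≥0} (hlam : Measurable lam)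
    (s w : ℝ≥0) : Measurable[pathFiltration d w] (fun ω : Path d => survival lam (s, ω) w) := by
  have h : Measurable (fun ω : Path d => survival lam (s, ω) w) :=
    (measurable_survival hlam).comp ((measurable_const.prodMk measurable_id).prodMk
      measurable_const)
  have := h.comp (measurable_stoppedPath (d := d) w)
  simpa [Function.comp_def, survival_stoppedPath] using this

theorem measurable_rate_mul_survival_pathFiltration {lam : ℝ≥0 × State d → ℝ≥0}
    (hlam : Measurable lam) (s w : ℝ≥0) : Measurable[pathFiltration d w]
      (fun ω : Path d => lam (s + w, ω w) * survival lam (s, ω) w) := by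
  have h : Measurable (fun x : State d => (lam (s + w, x) : ℝ)) :=
    (hlam.comp measurable_prodMk_left).coe_nnreal_real
  exact (h.comp (measurable_coord_pathFiltration le_rfl)).mul
    (measurable_survival_pathFiltration hlam s w)

/-! ### The compensated martingale weighted by the switching density. -/

theorem measurable_compensated {g a : ℝ≥0 × State d → ℝ} (hg : Measurable g) (ha : Measurable a) :
    Measurable (fun q : (ℝ≥0 × Path d) × ℝ≥0 => compensated g a q.1.1 q.2 q.1.2) := by
  refine ((hg.comp measurable_timeSpace).sub (hg.comp ?_)).sub (measurable_setIntegral_path ha)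
  exact measurable_fst.fst.prodMk ((measurable_coord 0).comp measurable_fst.snd)

theorem abs_compensated_le {g a : ℝ≥0 × State d → ℝ} {D E : ℝ} (hg : ∀ p, |g p| ≤ D)
    (ha : ∀ p, |a p| ≤ E) (s w : ℝ≥0) (ω : Path d) :
    |compensated g a s w ω| ≤ 2 * D + E * w := by
  have h1 := hg (s + w, ω w)
  have h2 := hg (s, ω 0)
  have h3 := abs_setIntegral_timeMeasure_le (fun v => ha (s + v, ω v)) w
  unfold compensated
  rw [abs_le] at *
  constructor <;> linarith [h1.1, h1.2, h2.1, h2.2, h3.1, h3.2]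

theorem abs_rate_mul_survival_le {lam : ℝ≥0 × State d → ℝ≥0} {C : ℝ≥0} (hC : ∀ p, lam p ≤ C)
    (p : ℝ≥0 × State d) (q : ℝ≥0 × Path d) (w : ℝ≥0) : |(lam p : ℝ) * survival lam q w| ≤ C := by
  rw [abs_of_nonneg (mul_nonneg (NNReal.coe_nonneg _) (survival_nonneg _ _ _))]
  calc (lam p : ℝ) * survival lam q w ≤ C * 1 :=
        mul_le_mul (hC p) (survival_le_one _ _ _) (survival_nonneg _ _ _) C.coe_nonneg
    _ = C := mul_one _

theorem measurable_survival_right {lam : ℝ≥0 × State d → ℝ≥0} (hlam : Measurable lam)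
    (q : ℝ≥0 × Path d) : Measurable (survival lam q) :=
  (measurable_survival hlam).comp measurable_prodMk_left

theorem measurable_along_path {E : Type*} [MeasurableSpace E] {f : ℝ≥0 × State d → E}
    (hf : Measurable f) (s : ℝ≥0) (ω : Path d) : Measurable fun w => f (s + w, ω w) :=
  hf.comp ((measurable_timeSpace (d := d)).comp (measurable_prodMk_left (x := (s, ω))))

/-- Integration by parts along a path. -/
theorem survival_mul_sub_setIntegral {lam : ℝ≥0 × State d → ℝ≥0} (hlam : Measurable lam) {C : ℝ≥0}
    (hC : ∀ p, lam p ≤ C) {g a : ℝ≥0 × State d → ℝ} (hg : Measurable g) (ha : Measurable a)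
    {D E : ℝ} (hgD : ∀ p, |g p| ≤ D) (haE : ∀ p, |a p| ≤ E) (s u : ℝ≥0) (ω : Path d) :
    survival lam (s, ω) u * g (s + u, ω u) - ∫ w in Set.Iic u, survival lam (s, ω) w *
        (a (s + w, ω w) - lam (s + w, ω w) * g (s + w, ω w)) ∂timeMeasure =
      g (s, ω 0) + survival lam (s, ω) u * compensated g a s u ω +
        ∫ w in Set.Iic u, lam (s + w, ω w) * survival lam (s, ω) w *
          compensated g a s w ω ∂timeMeasure := by
  have hS := measurable_survival_right hlam (s, ω)
  have hl := (measurable_along_path hlam s ω).coe_nnreal_real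
  have hg' := measurable_along_path hg s ω
  have ha' := measurable_along_path ha s ω
  have hK := setIntegral_mul_survival hlam hC (s, ω)
  have hKm := hl.mul hS
  have hKb := fun w => abs_rate_mul_survival_le hC (s + w, ω w) (s, ω) w
  have hKi : IntegrableOn (fun w => lam (s + w, ω w) * survival lam (s, ω) w) (Set.Iic u)
      timeMeasure := integrable_of_bounded hKm.aestronglyMeasurable hKb
  have hSa : IntegrableOn (fun w => a (s + w, ω w) * survival lam (s, ω) w) (Set.Iic u)
      timeMeasure := integrable_of_bounded (C := E) (ha'.mul hS).aestronglyMeasurable fun w => by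
    rw [abs_mul, abs_of_nonneg (survival_nonneg _ _ _)]
    exact (mul_le_of_le_one_right (abs_nonneg _) (survival_le_one _ _ _)).trans (haE _)
  have hKg : IntegrableOn (fun w => lam (s + w, ω w) * survival lam (s, ω) w * g (s + w, ω w))
      (Set.Iic u) timeMeasure :=
    integrable_of_bounded (C := C * D) (hKm.mul hg').aestronglyMeasurable fun w => by
      rw [abs_mul]
      exact mul_le_mul (hKb w) (hgD _) (abs_nonneg _) C.coe_nonneg
  have hai : IntegrableOn (fun w => a (s + w, ω w)) (Set.Iic u) timeMeasure :=
    integrable_of_bounded ha'.aestronglyMeasurable fun w => haE _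
  have hAm : Measurable fun w => ∫ v in Set.Iic w, a (s + v, ω v) ∂timeMeasure :=
    (measurable_setIntegral_path ha).comp (measurable_prodMk_left (x := (s, ω)))
  have hKA : IntegrableOn (fun w => lam (s + w, ω w) * survival lam (s, ω) w *
      ∫ v in Set.Iic w, a (s + v, ω v) ∂timeMeasure) (Set.Iic u) timeMeasure := by
    refine Integrable.of_bound (hKm.mul hAm).aestronglyMeasurable (C * (E * u)) ?_
    filter_upwards [ae_restrict_mem measurableSet_Iic] with w hw
    rw [Real.norm_eq_abs, abs_mul]
    refine mul_le_mul (hKb w) ?_ (abs_nonneg _) C.coe_nonneg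
    refine (abs_setIntegral_timeMeasure_le (fun v => haE (s + v, ω v)) w).trans ?_
    exact mul_le_mul_of_nonneg_left (NNReal.coe_le_coe.2 hw) ((abs_nonneg _).trans (haE (0, 0)))
  -- Here `k = λ S`, whose integral up to `w` is `1 - S(w)`; the triangle identity yields `∫ a (S(v)
  -- - S(u)) dv`.
  have hparts := setIntegral_mul_setIntegral hKm ha' hKb (fun w => haE _) u
  simp only [Pi.mul_apply] at hparts
  simp only [hK] at hparts
  have e1 : ∫ v in Set.Iic u, a (s + v, ω v) * (1 - survival lam (s, ω) u -
        (1 - survival lam (s, ω) v)) ∂timeMeasure =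
      (∫ v in Set.Iic u, a (s + v, ω v) * survival lam (s, ω) v ∂timeMeasure) -
        (∫ v in Set.Iic u, a (s + v, ω v) ∂timeMeasure) * survival lam (s, ω) u := by
    rw [← integral_mul_const, ← integral_sub hSa (hai.mul_const _)]
    congr 1 with v
    ring
  have e2 : ∫ w in Set.Iic u, survival lam (s, ω) w *
        (a (s + w, ω w) - lam (s + w, ω w) * g (s + w, ω w)) ∂timeMeasure =
      (∫ v in Set.Iic u, a (s + v, ω v) * survival lam (s, ω) v ∂timeMeasure) -
        ∫ w in Set.Iic u, lam (s + w, ω w) * survival lam (s, ω) w * g (s + w, ω w)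
          ∂timeMeasure := by
    rw [← integral_sub hSa hKg]
    congr 1 with v
    ring
  have e3 : ∫ w in Set.Iic u, lam (s + w, ω w) * survival lam (s, ω) w *
          compensated g a s w ω ∂timeMeasure =
      (∫ w in Set.Iic u, lam (s + w, ω w) * survival lam (s, ω) w * g (s + w, ω w)
          ∂timeMeasure) -
        (∫ w in Set.Iic u, lam (s + w, ω w) * survival lam (s, ω) w ∂timeMeasure) * g (s, ω 0) -
        ∫ w in Set.Iic u, lam (s + w, ω w) * survival lam (s, ω) w *
          ∫ v in Set.Iic w, a (s + v, ω v) ∂timeMeasure ∂timeMeasure := by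
    have hdiff : IntegrableOn (fun w => lam (s + w, ω w) * survival lam (s, ω) w *
        g (s + w, ω w) - lam (s + w, ω w) * survival lam (s, ω) w * g (s, ω 0)) (Set.Iic u)
        timeMeasure := hKg.sub (hKi.mul_const _)
    rw [← integral_mul_const, ← integral_sub hKg (hKi.mul_const _), ← integral_sub hdiff hKA]
    congr 1 with w
    unfold compensated
    ring
  rw [e1] at hparts
  rw [e2, e3, hK, hparts]
  unfold compensated
  ring

/-- The expectation of a martingale against an adapted rate. -/
theorem integral_survival_mul {P : Measure (Path d)} [IsProbabilityMeasure P]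
    {lam : ℝ≥0 × State d → ℝ≥0} (hlam : Measurable lam) {C : ℝ≥0}
    (hC : ∀ p, lam p ≤ C) {g a : ℝ≥0 × State d → ℝ} (hg : Measurable g) (ha : Measurable a)
    {D E : ℝ} (hgD : ∀ p, |g p| ≤ D) (haE : ∀ p, |a p| ≤ E) (s u : ℝ≥0)
    (hmart : ∀ w ≤ u, P[compensated g a s u | pathFiltration d w] =ᵐ[P] compensated g a s w) :
    ∫ ω, (survival lam (s, ω) u * g (s + u, ω u) - ∫ w in Set.Iic u, survival lam (s, ω) w *
        (a (s + w, ω w) - lam (s + w, ω w) * g (s + w, ω w)) ∂timeMeasure) ∂P =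
      ∫ ω, g (s, ω 0) ∂P := by
  have hE0 : 0 ≤ E := (abs_nonneg _).trans (haE (0, 0))
  have hB : ∀ w ≤ u, ∀ ω : Path d, |compensated g a s w ω| ≤ 2 * D + E * u := fun w hw ω =>
    (abs_compensated_le hgD haE s w ω).trans (by
      have := mul_le_mul_of_nonneg_left (NNReal.coe_le_coe.2 hw) hE0
      linarith)
  have hmap : Measurable fun q : ℝ≥0 × Path d => (((s, q.2), q.1) : (ℝ≥0 × Path d) × ℝ≥0) :=
    (measurable_const.prodMk measurable_snd).prodMk measurable_fst
  have hM : Measurable fun q : ℝ≥0 × Path d => compensated g a s q.1 q.2 :=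
    (measurable_compensated hg ha).comp hmap
  have hMw : ∀ w, Measurable (compensated g a s w) := fun w => hM.comp measurable_prodMk_left
  have hMi : ∀ w ≤ u, Integrable (compensated g a s w) P := fun w hw =>
    integrable_of_bounded (hMw w).aestronglyMeasurable (hB w hw)
  have hS : Measurable fun q : ℝ≥0 × Path d => survival lam (s, q.2) q.1 :=
    (measurable_survival hlam).comp hmap
  have hK : Measurable fun q : ℝ≥0 × Path d =>
      (lam (s + q.1, q.2 q.1) : ℝ) * survival lam (s, q.2) q.1 :=
    (hlam.comp (measurable_timeSpace.comp hmap)).coe_nnreal_real.mul hS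
  -- The weight at time `w` is bounded and known at time `w`, so it can be pulled out of the
  -- conditional expectation of `M_u`, which is `M_w`.
  have hKM : ∀ w ≤ u, ∫ ω, lam (s + w, ω w) * survival lam (s, ω) w * compensated g a s w ω ∂P =
      ∫ ω, lam (s + w, ω w) * survival lam (s, ω) w * compensated g a s u ω ∂P := fun w hw => by
    have hKi : Integrable (fun ω : Path d =>
        lam (s + w, ω w) * survival lam (s, ω) w * compensated g a s u ω) P :=
      (hMi u le_rfl).bdd_mul (hK.comp measurable_prodMk_left).aestronglyMeasurable (c := C)
        (Eventually.of_forall fun ω => abs_rate_mul_survival_le hC _ _ _)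
    have h1 := condExp_mul_of_stronglyMeasurable_left (m := pathFiltration d w)
      (measurable_rate_mul_survival_pathFiltration hlam s w).stronglyMeasurable hKi (hMi u le_rfl)
    rw [← integral_condExp ((pathFiltration d).le w) (f := fun ω : Path d =>
        lam (s + w, ω w) * survival lam (s, ω) w * compensated g a s u ω)]
    refine integral_congr_ae ?_
    filter_upwards [h1, hmart w hw] with ω h1 h2
    refine Eq.trans ?_ h1.symm
    simp only [Pi.mul_apply, h2]
  have hM0 : ∫ ω, compensated g a s u ω ∂P = 0 := by
    rw [← integral_condExp ((pathFiltration d).le 0), integral_congr_ae (hmart 0 zero_le)]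
    have h0 : Set.Iic (0 : ℝ≥0) = {0} := by ext; simp
    simp [compensated, h0]
  have hjoint : ∀ F : ℝ≥0 × Path d → ℝ, Measurable F →
      (∀ w ≤ u, ∀ ω, |F (w, ω)| ≤ 2 * D + E * u) →
      Integrable (fun q : ℝ≥0 × Path d =>
        lam (s + q.1, q.2 q.1) * survival lam (s, q.2) q.1 * F q)
        ((timeMeasure.restrict (Set.Iic u)).prod P) := fun F hF hb => by
    refine Integrable.of_bound (hK.mul hF).aestronglyMeasurable (C * (2 * D + E * u)) ?_
    filter_upwards [Measure.quasiMeasurePreserving_fst.ae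
      (ae_restrict_mem (μ := timeMeasure) (measurableSet_Iic (a := u)))] with q hq
    rw [Real.norm_eq_abs, abs_mul]
    exact mul_le_mul (abs_rate_mul_survival_le hC _ _ _) (hb q.1 hq q.2) (abs_nonneg _)
      C.coe_nonneg
  have hj1 := hjoint _ hM hB
  have hj2 := hjoint (fun q => compensated g a s u q.2) ((hMw u).comp measurable_snd)
    (fun w _ ω => hB u le_rfl ω)
  -- Exchange the integrals, replace `M_w` by `M_u`, and exchange back; the weight then integrates
  -- to `1 - S(u)`.
  have hswap : ∫ ω, ∫ w in Set.Iic u, lam (s + w, ω w) * survival lam (s, ω) w *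
        compensated g a s w ω ∂timeMeasure ∂P =
      ∫ ω, (1 - survival lam (s, ω) u) * compensated g a s u ω ∂P := by
    rw [← integral_integral_swap hj1, setIntegral_congr_fun measurableSet_Iic hKM,
      integral_integral_swap hj2]
    congr 1 with ω
    rw [integral_mul_const]
    congr 1
    exact setIntegral_mul_survival hlam hC (s, ω) u
  have hSM : Integrable (fun ω => survival lam (s, ω) u * compensated g a s u ω) P :=
    (hMi u le_rfl).bdd_mul (hS.comp measurable_prodMk_left).aestronglyMeasurable (c := 1)
      (Eventually.of_forall fun ω => by
        rw [Real.norm_of_nonneg (survival_nonneg _ _ _)]; exact survival_le_one _ _ _)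
  have hg0 : Integrable (fun ω : Path d => g (s, ω 0)) P :=
    integrable_of_bounded (hg.comp (measurable_prodMk_left.comp
      (measurable_coord 0))).aestronglyMeasurable fun ω => hgD _
  simp_rw [survival_mul_sub_setIntegral hlam hC hg ha hgD haE s u]
  have hsum : Integrable (fun ω => g (s, ω 0) + survival lam (s, ω) u * compensated g a s u ω) P :=
    hg0.add hSM
  have hKint : Integrable (fun ω => ∫ w in Set.Iic u, lam (s + w, ω w) * survival lam (s, ω) w *
      compensated g a s w ω ∂timeMeasure) P := hj1.integral_prod_right
  rw [integral_add hsum hKint, integral_add hg0 hSM, hswap]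
  simp_rw [sub_mul, one_mul]
  rw [integral_sub (hMi u le_rfl) hSM, hM0]
  ring

/-! ### The law of the next switching. -/

/-- The law of the time until the next switching. -/
noncomputable def switchTimeMeasure (lam : ℝ≥0 × State d → ℝ≥0) (p : ℝ≥0 × Path d) :
    Measure ℝ≥0 := timeMeasure.withDensity (switchDensity lam p)

/-- The law of the new position when the path `ω` started at time `s` switches at time `s + v`. -/
noncomputable def switchPositionKernel (Q : Kernel (ℝ≥0 × State d) (State d)) (s : ℝ≥0)
    (ω : Path d) : Kernel ℝ≥0 (State d) :=
  Q.comap (fun v => (s + v, ω v)) (measurable_along_path measurable_id s ω)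

instance (Q : Kernel (ℝ≥0 × State d) (State d)) [IsMarkovKernel Q] (s : ℝ≥0) (ω : Path d) :
    IsMarkovKernel (switchPositionKernel Q s ω) := by
  unfold switchPositionKernel
  infer_instance

theorem switchDensity_eq (lam : ℝ≥0 × State d → ℝ≥0) (p : ℝ≥0 × Path d) (v : ℝ≥0) :
    switchDensity lam p v =
      ENNReal.ofReal (lam (p.1 + v, p.2 v) * survival lam p v) := by
  rw [ENNReal.ofReal_mul (NNReal.coe_nonneg _), ENNReal.ofReal_coe_nnreal]
  rfl

theorem measurable_switchDensity_right {lam : ℝ≥0 × State d → ℝ≥0} (hlam : Measurable lam)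
    (p : ℝ≥0 × Path d) : Measurable (switchDensity lam p) :=
  (measurable_switchDensity hlam).comp measurable_prodMk_left

theorem setIntegral_switchTimeMeasure {lam : ℝ≥0 × State d → ℝ≥0} (hlam : Measurable lam)
    (p : ℝ≥0 × Path d) {A : Set ℝ≥0} (hA : MeasurableSet A) (f : ℝ≥0 → ℝ) :
    ∫ v in A, f v ∂switchTimeMeasure lam p =
      ∫ v in A, lam (p.1 + v, p.2 v) * survival lam p v * f v ∂timeMeasure := by
  rw [switchTimeMeasure, setIntegral_withDensity_eq_setIntegral_toReal_smul
    (measurable_switchDensity_right hlam p) _ f hA]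
  · refine setIntegral_congr_fun hA fun v _ => ?_
    simp only [switchDensity_eq, smul_eq_mul]
    rw [ENNReal.toReal_ofReal (mul_nonneg (NNReal.coe_nonneg _) (survival_nonneg _ _ _))]
  · exact Eventually.of_forall fun v => by rw [switchDensity_eq]; exact ENNReal.ofReal_lt_top

theorem switchKernel_apply {lam : ℝ≥0 × State d → ℝ≥0} (hlam : Measurable lam)
    (Q : Kernel (ℝ≥0 × State d) (State d)) [IsMarkovKernel Q] (s : ℝ≥0) (ω : Path d) :
    switchKernel lam Q (s, ω) =
      ((switchTimeMeasure lam (s, ω)) ⊗ₘ (switchPositionKernel Q s ω)).map Prod.swap := by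
  rw [switchKernel, Kernel.map_apply _ measurable_swap,
    Kernel.compProd_apply_eq_compProd_sectR, Kernel.withDensity_apply _
      (measurable_switchDensity hlam), Kernel.const_apply]
  rfl

instance (lam : ℝ≥0 × State d → ℝ≥0) (p : ℝ≥0 × Path d) : SFinite (switchTimeMeasure lam p) := by
  unfold switchTimeMeasure
  infer_instance

theorem isProbabilityMeasure_switchTimeMeasure {lam : ℝ≥0 × State d → ℝ≥0} (hlam : Measurable lam)
    (Q : Kernel (ℝ≥0 × State d) (State d)) [IsMarkovKernel Q] (s : ℝ≥0) (ω : Path d)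
    [h : IsProbabilityMeasure (switchKernel lam Q (s, ω))] :
    IsProbabilityMeasure (switchTimeMeasure lam (s, ω)) := by
  have h1 := h.measure_univ
  rw [switchKernel_apply hlam, Measure.map_apply measurable_swap MeasurableSet.univ,
    Set.preimage_univ, ← Set.univ_prod_univ, Measure.compProd_apply_prod MeasurableSet.univ
    MeasurableSet.univ] at h1
  exact ⟨by simpa using h1⟩

theorem integral_switchKernel {lam : ℝ≥0 × State d → ℝ≥0} (hlam : Measurable lam)
    (Q : Kernel (ℝ≥0 × State d) (State d)) [IsMarkovKernel Q] (s : ℝ≥0) (ω : Path d)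
    [IsProbabilityMeasure (switchKernel lam Q (s, ω))] {F : State d × ℝ≥0 → ℝ} (hF : Measurable F)
    {C : ℝ} (hC : ∀ y, |F y| ≤ C) :
    ∫ y, F y ∂(switchKernel lam Q (s, ω)) =
      ∫ v, ∫ z, F (z, v) ∂(Q (s + v, ω v)) ∂(switchTimeMeasure lam (s, ω)) := by
  have := isProbabilityMeasure_switchTimeMeasure hlam Q s ω
  rw [switchKernel_apply hlam, integral_map measurable_swap.aemeasurable hF.aestronglyMeasurable,
    Measure.integral_compProd]
  · rfl
  · exact integrable_of_bounded (hF.comp measurable_swap).aestronglyMeasurable fun p => hC _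

theorem switchTimeMeasure_real_Iic {lam : ℝ≥0 × State d → ℝ≥0} (hlam : Measurable lam) {C : ℝ≥0}
    (hC : ∀ p, lam p ≤ C) (p : ℝ≥0 × Path d) (w : ℝ≥0) [IsFiniteMeasure (switchTimeMeasure lam p)] :
    (switchTimeMeasure lam p).real (Set.Iic w) = 1 - survival lam p w := by
  have := setIntegral_switchTimeMeasure hlam p (measurableSet_Iic (a := w)) (fun _ => 1)
  simp only [mul_one, setIntegral_const, smul_eq_mul] at this
  rw [this, setIntegral_mul_survival hlam hC]

theorem switchTimeMeasure_real_Ioi {lam : ℝ≥0 × State d → ℝ≥0} (hlam : Measurable lam) {C : ℝ≥0}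
    (hC : ∀ p, lam p ≤ C) (p : ℝ≥0 × Path d) (w : ℝ≥0)
    [IsProbabilityMeasure (switchTimeMeasure lam p)] :
    (switchTimeMeasure lam p).real (Set.Ioi w) = survival lam p w := by
  rw [← Set.compl_Iic, probReal_compl_eq_one_sub measurableSet_Iic,
    switchTimeMeasure_real_Iic hlam hC, sub_sub_cancel]

/-- With rate at most `C`, the path survives past time 1 with probability at least `exp(-C)`. Hence
the discount `exp(-v)` has mean bounded by a constant below 1, uniformly in the path and the
starting time. -/
theorem integral_exp_neg_switchKernel_le {lam : ℝ≥0 × State d → ℝ≥0} (hlam : Measurable lam)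
    {C : ℝ≥0} (hC : ∀ p, lam p ≤ C) (Q : Kernel (ℝ≥0 × State d) (State d)) [IsMarkovKernel Q]
    (s : ℝ≥0) (ω : Path d) [IsProbabilityMeasure (switchKernel lam Q (s, ω))] :
    ∫ y, Real.exp (-y.2) ∂(switchKernel lam Q (s, ω)) ≤
      1 - (1 - Real.exp (-1)) * Real.exp (-C) := by
  have := isProbabilityMeasure_switchTimeMeasure hlam Q s ω
  have hm : Measurable fun v : ℝ≥0 => Real.exp (-v) :=
    Real.measurable_exp.comp measurable_coe_nnreal_real.neg
  have hb : ∀ v : ℝ≥0, |Real.exp (-v)| ≤ 1 := fun v => by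
    rw [abs_of_pos (Real.exp_pos _)]
    exact Real.exp_le_one_iff.2 (neg_nonpos.2 v.coe_nonneg)
  rw [integral_switchKernel hlam Q s ω (F := fun y => Real.exp (-y.2))
    (hm.comp measurable_snd) (C := 1) fun y => hb _]
  simp only [integral_const, probReal_univ, one_smul]
  have hle : ∀ v : ℝ≥0, Real.exp (-v) ≤
      Real.exp (-1) + (Set.Iic (1 : ℝ≥0)).indicator (fun _ => 1 - Real.exp (-1)) v := fun v => by
    by_cases h : v ≤ 1
    · simp [h]
    · have h' : (1 : ℝ) ≤ v := by exact_mod_cast (not_le.1 h).le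
      simpa [h] using h'
  have hind : Integrable ((Set.Iic (1 : ℝ≥0)).indicator fun _ => 1 - Real.exp (-1))
      (switchTimeMeasure lam (s, ω)) := (integrable_const _).indicator measurableSet_Iic
  refine (integral_mono (integrable_of_bounded hm.aestronglyMeasurable hb)
    ((integrable_const _).add hind) hle).trans ?_
  rw [integral_add' (integrable_const _) hind, integral_indicator measurableSet_Iic,
    setIntegral_const, switchTimeMeasure_real_Iic hlam hC]
  have h1 := exp_neg_le_survival hC (s, ω) 1
  have h2 : Real.exp (-1) ≤ 1 := Real.exp_le_one_iff.2 (by norm_num)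
  simp only [integral_const, probReal_univ, smul_eq_mul, NNReal.coe_one, mul_one] at *
  nlinarith

/-- By Fubini: the switching comes after `w` with probability `S(w)`. -/
theorem integral_integral_lt_switchTimeMeasure {lam : ℝ≥0 × State d → ℝ≥0}
    (hlam : Measurable lam) {C : ℝ≥0} (hC : ∀ p, lam p ≤ C) (p : ℝ≥0 × Path d)
    [IsProbabilityMeasure (switchTimeMeasure lam p)] {H : ℝ≥0 → ℝ} (hH : Measurable H) {E : ℝ}
    (hE : ∀ w, |H w| ≤ E) (u : ℝ≥0) :
    ∫ v, ∫ w in Set.Iic u, (if w < v then H w else 0) ∂timeMeasure ∂switchTimeMeasure lam p =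
      ∫ w in Set.Iic u, survival lam p w * H w ∂timeMeasure := by
  have hE0 : 0 ≤ E := (abs_nonneg _).trans (hE 0)
  rw [integral_integral_swap]
  · congr 1 with w
    have : (fun v => if w < v then H w else 0) = (Set.Ioi w).indicator fun _ => H w := rfl
    rw [this, integral_indicator measurableSet_Ioi, setIntegral_const,
      switchTimeMeasure_real_Ioi hlam hC, smul_eq_mul]
  · refine integrable_of_bounded (C := E) (Measurable.ite (measurableSet_lt measurable_snd
      measurable_fst) (hH.comp measurable_snd) measurable_const).aestronglyMeasurable fun q => ?_
    simp only [Function.uncurry]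
    split_ifs
    · exact hE _
    · simpa using hE0

/-! ### One stretch along a fixed path. -/

/-- The path functional whose expectation is computed in `integral_switchKernel_step`: the value
of `g` at the first switching or at time `u`, minus the integral of `h` up to then. -/
noncomputable def stepFunctional (g h : ℝ≥0 × State d → ℝ) (s : ℝ≥0) (ω : Path d) (u : ℝ≥0)
    (y : State d × ℝ≥0) : ℝ :=
  (if y.2 ≤ u then g (s + y.2, y.1) else g (s + u, ω u)) -
    ∫ w in Set.Iic u, (if w < y.2 then h (s + w, ω w) else 0) ∂timeMeasure

theorem measurable_stepFunctional {g h : ℝ≥0 × State d → ℝ} (hg : Measurable g)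
    (hh : Measurable h) :
    Measurable fun q : ((ℝ≥0 × Path d) × ℝ≥0) × (State d × ℝ≥0) =>
      stepFunctional g h q.1.1.1 q.1.1.2 q.1.2 q.2 := by
  refine Measurable.sub (Measurable.ite (measurableSet_le measurable_snd.snd measurable_fst.snd)
    ?_ ?_) ?_
  · exact hg.comp ((measurable_fst.fst.fst.add measurable_snd.snd).prodMk measurable_snd.fst)
  · exact hg.comp (measurable_timeSpace.comp measurable_fst)
  · exact (measurable_setIntegral_Iic (f := fun r : ((ℝ≥0 × Path d) × (State d × ℝ≥0)) × ℝ≥0 =>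
      if r.2 < r.1.2.2 then h (r.1.1.1 + r.2, r.1.1.2 r.2) else 0)
      (Measurable.ite (measurableSet_lt measurable_snd measurable_fst.snd.snd)
        (hh.comp (measurable_timeSpace.comp (measurable_fst.fst.prodMk measurable_snd)))
        measurable_const)).comp
      ((measurable_fst.fst.prodMk measurable_snd).prodMk measurable_fst.snd)

theorem abs_ite_zero_le {p : Prop} [Decidable p] {x E : ℝ} (h : |x| ≤ E) :
    |if p then x else 0| ≤ E := by
  split_ifs
  · exact h
  · simpa using (abs_nonneg x).trans h

theorem abs_stepFunctional_le {g h : ℝ≥0 × State d → ℝ} {D E : ℝ} (hg : ∀ p, |g p| ≤ D)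
    (hh : ∀ p, |h p| ≤ E) (s : ℝ≥0) (ω : Path d) (u : ℝ≥0) (y : State d × ℝ≥0) :
    |stepFunctional g h s ω u y| ≤ D + E * u := by
  refine (abs_sub _ _).trans (add_le_add ?_ ?_)
  · split_ifs <;> exact hg _
  · exact abs_setIntegral_timeMeasure_le (fun w => abs_ite_zero_le (hh _)) u

/-- The switching time has density `λ S` on `[0, u]` and mass `S(u)` beyond `u`, while the running
term `h` at `w` counts with weight `S(w)`. -/
theorem integral_switchKernel_step {lam : ℝ≥0 × State d → ℝ≥0} (hlam : Measurable lam) {C : ℝ≥0}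
    (hC : ∀ p, lam p ≤ C) (Q : Kernel (ℝ≥0 × State d) (State d)) [IsMarkovKernel Q]
    (s : ℝ≥0) (ω : Path d) [IsProbabilityMeasure (switchKernel lam Q (s, ω))]
    {g h : ℝ≥0 × State d → ℝ} (hg : Measurable g) (hh : Measurable h) {D E : ℝ}
    (hgD : ∀ p, |g p| ≤ D) (hhE : ∀ p, |h p| ≤ E) (u : ℝ≥0) :
    ∫ y, stepFunctional g h s ω u y ∂(switchKernel lam Q (s, ω)) =
      survival lam (s, ω) u * g (s + u, ω u) +
        ∫ v in Set.Iic u, survival lam (s, ω) v * (lam (s + v, ω v) *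
          (∫ z, g (s + v, z) ∂(Q (s + v, ω v))) - h (s + v, ω v)) ∂timeMeasure := by
  have := isProbabilityMeasure_switchTimeMeasure hlam Q s ω
  have hSm := measurable_survival_right hlam (s, ω)
  have hlm := (measurable_along_path hlam s ω).coe_nnreal_real
  have hhm := measurable_along_path hh s ω
  have hQm : Measurable fun v => ∫ z, g (s + v, z) ∂(Q (s + v, ω v)) := by
    have h1 : Measurable fun p : ℝ≥0 × State d => ∫ z, g (p.1, z) ∂(Q p) :=
      (StronglyMeasurable.integral_kernel_prod_right' (κ := Q)
        (f := fun r : (ℝ≥0 × State d) × State d => g (r.1.1, r.2))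
        (hg.comp (measurable_fst.fst.prodMk measurable_snd)).stronglyMeasurable).measurable
    exact measurable_along_path h1 s ω
  have hQb : ∀ p : ℝ≥0 × State d, |∫ z, g (p.1, z) ∂(Q p)| ≤ D := fun p => by
    have := norm_integral_le_of_norm_le_const (μ := Q p) (f := fun z => g (p.1, z)) (C := D)
      (Eventually.of_forall fun z => hgD (p.1, z))
    simpa using this
  have hm : Measurable (stepFunctional g h s ω u) :=
    (measurable_stepFunctional hg hh).comp (measurable_prodMk_left (x := ((s, ω), u)))
  rw [integral_switchKernel hlam Q s ω hm fun y => abs_stepFunctional_le hgD hhE s ω u y]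
  -- Only `g` at a switching before `u` depends on the new position `z`.
  have hin : ∀ v, ∫ z, stepFunctional g h s ω u (z, v) ∂(Q (s + v, ω v)) =
      ((Set.Iic u).indicator (fun v => ∫ z, g (s + v, z) ∂(Q (s + v, ω v))) v +
        (Set.Ioi u).indicator (fun _ => g (s + u, ω u)) v) -
        ∫ w in Set.Iic u, (if w < v then h (s + w, ω w) else 0) ∂timeMeasure := fun v => by
    change ∫ z, ((if v ≤ u then g (s + v, z) else g (s + u, ω u)) -
      ∫ w in Set.Iic u, (if w < v then h (s + w, ω w) else 0) ∂timeMeasure) ∂(Q (s + v, ω v)) = _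
    generalize (∫ w in Set.Iic u, (if w < v then h (s + w, ω w) else 0) ∂timeMeasure) = B
    by_cases hv : v ≤ u
    · have hi : Integrable (fun z => g (s + v, z)) (Q (s + v, ω v)) :=
        integrable_of_bounded (hg.comp measurable_prodMk_left).aestronglyMeasurable fun z => hgD _
      simp only [hv, if_true]
      rw [integral_sub hi (integrable_const _)]
      simp [hv]
    · simp [hv, lt_of_not_ge hv]
  have hi1 : Integrable ((Set.Iic u).indicator fun v => ∫ z, g (s + v, z) ∂(Q (s + v, ω v)))
      (switchTimeMeasure lam (s, ω)) :=
    (integrable_of_bounded hQm.aestronglyMeasurable fun v => hQb _).indicator measurableSet_Iic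
  have hi2 : Integrable ((Set.Ioi u).indicator fun _ => g (s + u, ω u))
      (switchTimeMeasure lam (s, ω)) := (integrable_const _).indicator measurableSet_Ioi
  have hi3 : Integrable (fun v => ∫ w in Set.Iic u, (if w < v then h (s + w, ω w) else 0)
      ∂timeMeasure) (switchTimeMeasure lam (s, ω)) := by
    refine integrable_of_bounded (C := E * u) (Measurable.aestronglyMeasurable ?_)
      fun v => abs_setIntegral_timeMeasure_le (fun w => abs_ite_zero_le (hhE _)) u
    exact (StronglyMeasurable.integral_prod_right (f := fun v w : ℝ≥0 =>
      if w < v then h (s + w, ω w) else 0) (Measurable.ite (measurableSet_lt measurable_snd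
      measurable_fst) (hhm.comp measurable_snd) measurable_const).stronglyMeasurable).measurable
  have hi12 : Integrable (fun v => (Set.Iic u).indicator
      (fun v => ∫ z, g (s + v, z) ∂(Q (s + v, ω v))) v +
        (Set.Ioi u).indicator (fun _ => g (s + u, ω u)) v) (switchTimeMeasure lam (s, ω)) :=
    hi1.add hi2
  simp_rw [hin]
  rw [integral_sub hi12 hi3, integral_add hi1 hi2, integral_indicator measurableSet_Iic,
    integral_indicator measurableSet_Ioi, setIntegral_const,
    switchTimeMeasure_real_Ioi hlam hC, setIntegral_switchTimeMeasure hlam _ measurableSet_Iic,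
    integral_integral_lt_switchTimeMeasure hlam hC _ hhm (fun w => hhE _), smul_eq_mul,
    add_comm (∫ v in Set.Iic u, _ ∂timeMeasure), add_sub_assoc, ← integral_sub]
  · congr 2 with v
    ring
  · refine integrable_of_bounded (C := C * D) ((hlm.mul hSm).mul hQm).aestronglyMeasurable
      fun v => ?_
    rw [abs_mul]
    exact mul_le_mul (abs_rate_mul_survival_le hC _ _ _) (hQb _) (abs_nonneg _) C.coe_nonneg
  · refine integrable_of_bounded (C := E) (hSm.mul hhm).aestronglyMeasurable fun v => ?_
    rw [abs_mul, abs_of_nonneg (survival_nonneg _ _ _)]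
    exact (mul_le_of_le_one_left (abs_nonneg _) (survival_le_one _ _ _)).trans (hhE _)

/-! ### Conditional laws given by a kernel not assumed Markov. -/

section CondDistrib

variable {Ω 𝓧 𝓨 : Type*} [MeasurableSpace Ω] [MeasurableSpace 𝓧] [MeasurableSpace 𝓨]
  {μ : Measure Ω} [IsProbabilityMeasure μ] {X : Ω → 𝓧} {Y : Ω → 𝓨} {κ : Kernel 𝓧 𝓨}
  [IsSFiniteKernel κ]

/-- The joint law has the law of `X` as first marginal, which forces `κ x` to have mass 1 for almost
every `x`. It is needed for `switchKernel`, which loses mass on paths with finite total rate. -/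
theorem ae_isProbabilityMeasure_of_hasCondDistrib (h : HasCondDistrib Y X κ μ) :
    ∀ᵐ x ∂(μ.map X), IsProbabilityMeasure (κ x) := by
  have hX := h.aemeasurable_fst
  have : IsProbabilityMeasure (μ.map X) := Measure.isProbabilityMeasure_map hX
  have hae : (fun x => κ x Set.univ) =ᵐ[μ.map X] fun _ => 1 := by
    refine ae_eq_of_forall_setLIntegral_eq_of_sigmaFinite
      (κ.measurable_coe MeasurableSet.univ) measurable_const fun s hs _ => ?_
    rw [← Measure.compProd_apply_prod hs MeasurableSet.univ, ← h.map_eq,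
      Measure.map_apply_of_aemeasurable h.aemeasurable (hs.prod MeasurableSet.univ),
      setLIntegral_const, one_mul, Measure.map_apply_of_aemeasurable hX hs]
    congr 1
    ext ω
    simp
  filter_upwards [hae] with x hx
  exact ⟨hx⟩

theorem integral_of_hasCondDistrib (h : HasCondDistrib Y X κ μ) {F : 𝓧 × 𝓨 → ℝ}
    (hF : Measurable F) {C : ℝ} (hC : ∀ p, |F p| ≤ C) :
    ∫ ω, F (X ω, Y ω) ∂μ = ∫ x, ∫ y, F (x, y) ∂(κ x) ∂(μ.map X) := by
  have hX := h.aemeasurable_fst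
  have : IsProbabilityMeasure (μ.map X) := Measure.isProbabilityMeasure_map hX
  have : IsProbabilityMeasure (μ.map X ⊗ₘ κ) :=
    h.map_eq ▸ Measure.isProbabilityMeasure_map h.aemeasurable
  rw [← Measure.integral_compProd (integrable_of_bounded hF.aestronglyMeasurable hC), ← h.map_eq,
    integral_map h.aemeasurable hF.aestronglyMeasurable]

end CondDistrib

/-! ### The generator with switching and the balance over one stretch. -/

theorem measurable_withSwitching {lam : ℝ≥0 × State d → ℝ≥0} (hlam : Measurable lam)
    (Q : Kernel (ℝ≥0 × State d) (State d)) [IsMarkovKernel Q] {g a : ℝ≥0 × State d → ℝ}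
    (hg : Measurable g) (ha : Measurable a) : Measurable (withSwitching lam Q g a) := by
  refine ha.add (hlam.coe_nnreal_real.mul ?_)
  exact (StronglyMeasurable.integral_kernel_prod_right' (κ := Q)
    (f := fun r : (ℝ≥0 × State d) × State d => g (r.1.1, r.2) - g r.1)
    ((hg.comp (measurable_fst.fst.prodMk measurable_snd)).sub
      (hg.comp measurable_fst)).stronglyMeasurable).measurable

theorem abs_withSwitching_le {lam : ℝ≥0 × State d → ℝ≥0} {C : ℝ≥0} (hC : ∀ p, lam p ≤ C)
    (Q : Kernel (ℝ≥0 × State d) (State d)) [IsMarkovKernel Q] {g a : ℝ≥0 × State d → ℝ}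
    {D E : ℝ} (hgD : ∀ p, |g p| ≤ D) (haE : ∀ p, |a p| ≤ E) (p : ℝ≥0 × State d) :
    |withSwitching lam Q g a p| ≤ E + C * (2 * D) := by
  refine (abs_add_le _ _).trans (add_le_add (haE p) ?_)
  rw [abs_mul, NNReal.abs_eq]
  refine mul_le_mul (hC p) ?_ (abs_nonneg _) C.coe_nonneg
  have := norm_integral_le_of_norm_le_const (μ := Q p) (f := fun z => g (p.1, z) - g p)
    (C := 2 * D) (Eventually.of_forall fun z => (norm_sub_le _ _).trans (by
      rw [two_mul]; exact add_le_add (hgD _) (hgD _)))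
  simpa using this

theorem withSwitching_eq (lam : ℝ≥0 × State d → ℝ≥0) (Q : Kernel (ℝ≥0 × State d) (State d))
    [IsMarkovKernel Q] {g : ℝ≥0 × State d → ℝ} (a : ℝ≥0 × State d → ℝ) (hg : Measurable g) {D : ℝ}
    (hgD : ∀ p, |g p| ≤ D) (p : ℝ≥0 × State d) :
    withSwitching lam Q g a p = a p + lam p * ((∫ z, g (p.1, z) ∂(Q p)) - g p) := by
  have hi : Integrable (fun z => g (p.1, z)) (Q p) :=
    integrable_of_bounded (hg.comp measurable_prodMk_left).aestronglyMeasurable fun z => hgD _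
  rw [withSwitching, integral_sub hi (integrable_const _)]
  simp

/-- Balance between two successive switchings: the switching started at time `S` from `Y`, along
the path `Z`, up to the fixed time `t`. -/
theorem integral_stepFunctional {P : Kernel (ℝ≥0 × State d) (Path d)} [IsMarkovKernel P]
    (hP : ∀ s x, ∀ᵐ ω ∂(P (s, x)), ω 0 = x) {lam : ℝ≥0 × State d → ℝ≥0} (hlam : Measurable lam)
    {C : ℝ≥0} (hC : ∀ p, lam p ≤ C) (Q : Kernel (ℝ≥0 × State d) (State d)) [IsMarkovKernel Q]
    {g a : ℝ≥0 × State d → ℝ} (hg : Measurable g) (ha : Measurable a) {D E : ℝ}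
    (hgD : ∀ p, |g p| ≤ D) (haE : ∀ p, |a p| ≤ E) (t : ℝ≥0)
    (hmart : ∀ s x u, s + u = t → ∀ w ≤ u,
      (P (s, x))[compensated g a s u | pathFiltration d w] =ᵐ[P (s, x)] compensated g a s w)
    {Ω : Type*} [MeasurableSpace Ω] {μ : Measure Ω} [IsProbabilityMeasure μ] {S : Ω → ℝ≥0}
    {Y : Ω → State d} {Z : Ω → Path d} {V : Ω → State d × ℝ≥0}
    (hZ : HasCondDistrib Z (fun ω => (S ω, Y ω)) P μ)
    (hV : HasCondDistrib V (fun ω => (S ω, Z ω)) (switchKernel lam Q) μ) :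
    ∫ ω, (if S ω ≤ t then
        stepFunctional g (withSwitching lam Q g a) (S ω) (Z ω) (t - S ω) (V ω) else 0) ∂μ =
      ∫ ω, (if S ω ≤ t then g (S ω, Y ω) else 0) ∂μ := by
  have hD0 : 0 ≤ D := (abs_nonneg _).trans (hgD (0, 0))
  have hE0 : 0 ≤ E := (abs_nonneg _).trans (haE (0, 0))
  have hh := measurable_withSwitching hlam Q hg ha
  have hhB := abs_withSwitching_le hC Q hgD haE
  set h := withSwitching lam Q g a with h_def
  set B := E + C * (2 * D)
  have hB0 : 0 ≤ B := (abs_nonneg _).trans (hhB (0, 0))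
  have hsub : ∀ s : ℝ≥0, ((t - s : ℝ≥0) : ℝ) ≤ t := fun s => NNReal.coe_le_coe.2 tsub_le_self
  have hms : MeasurableSet {q : (ℝ≥0 × Path d) × (State d × ℝ≥0) | q.1.1 ≤ t} :=
    measurableSet_le measurable_fst.fst measurable_const
  have hF : Measurable fun q : (ℝ≥0 × Path d) × (State d × ℝ≥0) =>
      if q.1.1 ≤ t then stepFunctional g h q.1.1 q.1.2 (t - q.1.1) q.2 else 0 :=
    Measurable.ite hms ((measurable_stepFunctional hg hh).comp
      ((measurable_fst.prodMk (measurable_const.sub measurable_fst.fst)).prodMk measurable_snd))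
      measurable_const
  -- Two disintegrations follow: over the next switching given start time and path, then over the
  -- path given start time and position.
  have e1 := integral_of_hasCondDistrib hV hF (C := D + B * t) fun q => abs_ite_zero_le
    ((abs_stepFunctional_le hgD hhB _ _ _ _).trans
      (add_le_add le_rfl (mul_le_mul_of_nonneg_left (hsub _) hB0)))
  set k : (ℝ≥0 × Path d) × ℝ≥0 → ℝ := fun r => survival lam r.1 r.2 *
    (a (r.1.1 + r.2, r.1.2 r.2) - lam (r.1.1 + r.2, r.1.2 r.2) * g (r.1.1 + r.2, r.1.2 r.2))
    with hk_def
  have hk : Measurable k := (measurable_survival hlam).mul ((ha.comp measurable_timeSpace).sub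
    ((hlam.comp measurable_timeSpace).coe_nnreal_real.mul (hg.comp measurable_timeSpace)))
  have hkb : ∀ r, |k r| ≤ E + C * D := fun r => by
    rw [hk_def, abs_mul, abs_of_nonneg (survival_nonneg _ _ _)]
    refine (mul_le_of_le_one_left (abs_nonneg _) (survival_le_one _ _ _)).trans
      ((abs_sub _ _).trans (add_le_add (haE _) ?_))
    rw [abs_mul, NNReal.abs_eq]
    exact mul_le_mul (hC _) (hgD _) (abs_nonneg _) C.coe_nonneg
  set φ : ℝ≥0 × Path d → ℝ := fun p => if p.1 ≤ t then
    survival lam p (t - p.1) * g (p.1 + (t - p.1), p.2 (t - p.1)) -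
      ∫ w in Set.Iic (t - p.1), k (p, w) ∂timeMeasure else 0 with hφ_def
  have hφ : Measurable φ := by
    have hm : Measurable fun p : ℝ≥0 × Path d => (p, t - p.1) :=
      measurable_id.prodMk (measurable_const.sub measurable_fst)
    refine Measurable.ite (measurableSet_le measurable_fst measurable_const) (Measurable.sub
      (((measurable_survival hlam).comp hm).mul ((hg.comp measurable_timeSpace).comp hm))
      ((measurable_setIntegral_Iic hk).comp hm)) measurable_const
  have hφb : ∀ p, |φ p| ≤ D + (E + C * D) * t := fun p => by
    refine abs_ite_zero_le ((abs_sub _ _).trans (add_le_add ?_ ?_))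
    · rw [abs_mul, abs_of_nonneg (survival_nonneg _ _ _)]
      exact (mul_le_of_le_one_left (abs_nonneg _) (survival_le_one _ _ _)).trans (hgD _)
    · exact (abs_setIntegral_timeMeasure_le (fun w => hkb (p, w)) _).trans
        (mul_le_mul_of_nonneg_left (hsub _) (by positivity))
  have hSZ := hV.aemeasurable_fst
  have hSY := hZ.aemeasurable_fst
  have hstep : ∀ᵐ p ∂(μ.map fun ω => (S ω, Z ω)), ∫ y, (if p.1 ≤ t then
      stepFunctional g h p.1 p.2 (t - p.1) y else 0) ∂(switchKernel lam Q p) = φ p := by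
    filter_upwards [ae_isProbabilityMeasure_of_hasCondDistrib hV] with p hp
    rw [hφ_def]
    by_cases hpt : p.1 ≤ t
    · simp only [hpt, if_true]
      have : IsProbabilityMeasure (switchKernel lam Q (p.1, p.2)) := hp
      refine (integral_switchKernel_step hlam hC Q p.1 p.2 hg hh hgD hhB (t - p.1)).trans ?_
      -- The `Q`-integral inside `h` cancels the gain term `λ ∫ g dQ`, leaving the integrand `-k`.
      rw [sub_eq_add_neg, ← integral_neg]
      congr 2 with w
      rw [hk_def, h_def, withSwitching_eq lam Q a hg hgD]
      ring
    · simp [hpt]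
  have hpath : ∀ p : ℝ≥0 × State d, ∫ ω, φ (p.1, ω) ∂(P p) = if p.1 ≤ t then g p else 0 := by
    rintro ⟨s, x⟩
    rw [hφ_def]
    by_cases hst : s ≤ t
    · simp only [hst, if_true]
      refine (integral_survival_mul hlam hC hg ha hgD haE s (t - s)
        (hmart s x (t - s) (add_tsub_cancel_of_le hst))).trans ?_
      rw [integral_congr_ae (g := fun _ => g (s, x))
        ((hP s x).mono fun ω hω => by simp only [hω])]
      simp
    · simp [hst]
  rw [e1, integral_congr_ae hstep, integral_map hSZ hφ.aestronglyMeasurable,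
    integral_of_hasCondDistrib hZ (F := fun q => φ (q.1.1, q.2))
      (hφ.comp (measurable_fst.fst.prodMk measurable_snd)) fun q => hφb _]
  simp_rw [hpath]
  rw [integral_map hSY]
  exact (Measurable.ite (measurableSet_le measurable_fst measurable_const) hg
    measurable_const).aestronglyMeasurable

/-! ### Conditional laws in the construction and non-accumulation of switchings. -/

variable {Ω : Type*} [MeasurableSpace Ω] {P : Kernel (ℝ≥0 × State d) (Path d)}
  {lam : ℝ≥0 × State d → ℝ≥0} {Q : Kernel (ℝ≥0 × State d) (State d)} {ζ : ℕ → Ω → Path d}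
  {Y : ℕ → Ω → State d} {T : ℕ → Ω → ℝ≥0} {X : ℝ≥0 → Ω → State d} {μ : Measure Ω}

namespace IsConstruction

theorem aemeasurable_path (hX : IsConstruction P lam Q ζ Y T X μ) (n : ℕ) :
    AEMeasurable (ζ n) μ := (hX.law_path n).aemeasurable_snd

theorem aemeasurable_switch (hX : IsConstruction P lam Q ζ Y T X μ) (n : ℕ) :
    AEMeasurable (fun ω => (Y n ω, T n ω)) μ :=
  (measurable_pi_apply (Fin.last n)).comp_aemeasurable (hX.law_path n).aemeasurable_fst.snd

theorem aemeasurable_time (hX : IsConstruction P lam Q ζ Y T X μ) (n : ℕ) :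
    AEMeasurable (T n) μ := (hX.aemeasurable_switch n).snd

/-- The prescribed law depends on the history only through `(T n, Y n)`, so conditioning reduces to
that pair. -/
theorem hasCondDistrib_path [IsMarkovKernel P] [IsProbabilityMeasure μ]
    (hX : IsConstruction P lam Q ζ Y T X μ) (n : ℕ) :
    HasCondDistrib (ζ n) (fun ω => (T n ω, Y n ω)) P μ := (hX.law_path n).comp_right

theorem hasCondDistrib_switch [IsProbabilityMeasure μ]
    (hX : IsConstruction P lam Q ζ Y T X μ) (n : ℕ) :
    HasCondDistrib (fun ω => (Y (n + 1) ω, T (n + 1) ω - T n ω)) (fun ω => (T n ω, ζ n ω))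
      (switchKernel lam Q) μ := (hX.law_switch n).comp_right

/-- Factor `exp(-T_{n+1})` over the last waiting time and average that factor given `(T n, ζ n)`. -/
theorem integral_exp_neg_time_succ_le [IsMarkovKernel Q] [IsProbabilityMeasure μ]
    (hX : IsConstruction P lam Q ζ Y T X μ) (hlam : Measurable lam) {C : ℝ≥0}
    (hC : ∀ p, lam p ≤ C) (n : ℕ) :
    ∫ ω, Real.exp (-T (n + 1) ω) ∂μ ≤
      (1 - (1 - Real.exp (-1)) * Real.exp (-C)) * ∫ ω, Real.exp (-T n ω) ∂μ := by
  have hm : Measurable fun v : ℝ≥0 => Real.exp (-v) :=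
    Real.measurable_exp.comp measurable_coe_nnreal_real.neg
  have hb : ∀ v : ℝ≥0, |Real.exp (-v)| ≤ 1 := fun v => by
    rw [abs_of_pos (Real.exp_pos _)]
    exact Real.exp_le_one_iff.2 (neg_nonpos.2 v.coe_nonneg)
  have hV := hX.hasCondDistrib_switch n
  have hA := hV.aemeasurable_fst
  have : IsProbabilityMeasure (μ.map fun ω => (T n ω, ζ n ω)) :=
    Measure.isProbabilityMeasure_map hA
  have e1 : ∫ ω, Real.exp (-T (n + 1) ω) ∂μ =
      ∫ ω, Real.exp (-T n ω) * Real.exp (-((T (n + 1) ω - T n ω : ℝ≥0) : ℝ)) ∂μ := by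
    refine integral_congr_ae ?_
    filter_upwards [hX.time_mono] with ω hω
    rw [← Real.exp_add, NNReal.coe_sub (hω n.le_succ)]
    congr 1
    ring
  have hF : Measurable fun q : (ℝ≥0 × Path d) × (State d × ℝ≥0) =>
      Real.exp (-q.1.1) * Real.exp (-q.2.2) :=
    (hm.comp measurable_fst.fst).mul (hm.comp measurable_snd.snd)
  have hFb : ∀ q : (ℝ≥0 × Path d) × (State d × ℝ≥0),
      |Real.exp (-q.1.1) * Real.exp (-q.2.2)| ≤ 1 := fun q => by
    rw [abs_mul]
    exact mul_le_one₀ (hb _) (abs_nonneg _) (hb _)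
  have e2 := integral_of_hasCondDistrib hV hF hFb
  rw [e1, e2]
  have hint : Integrable (fun p : ℝ≥0 × Path d => Real.exp (-p.1))
      (μ.map fun ω => (T n ω, ζ n ω)) :=
    integrable_of_bounded (hm.comp measurable_fst).aestronglyMeasurable fun p => hb _
  rw [← integral_map (f := fun p : ℝ≥0 × Path d => Real.exp (-p.1)) hA
    hint.aestronglyMeasurable, ← integral_const_mul]
  refine integral_mono_of_nonneg (Eventually.of_forall fun p => integral_nonneg fun y =>
    by positivity) (hint.const_mul _) ?_
  filter_upwards [ae_isProbabilityMeasure_of_hasCondDistrib hV] with p hp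
  have : IsProbabilityMeasure (switchKernel lam Q (p.1, p.2)) := hp
  simp only [integral_const_mul]
  rw [mul_comm]
  exact mul_le_mul_of_nonneg_right (integral_exp_neg_switchKernel_le hlam hC Q p.1 p.2)
    (Real.exp_pos _).le

/-- The switching times almost surely do not accumulate. -/
theorem ae_exists_lt_time [IsMarkovKernel Q] [IsProbabilityMeasure μ]
    (hX : IsConstruction P lam Q ζ Y T X μ) (hlam : Measurable lam) {C : ℝ≥0}
    (hC : ∀ p, lam p ≤ C) : ∀ᵐ ω ∂μ, ∀ t, ∃ n, t < T n ω := by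
  set c := 1 - (1 - Real.exp (-1)) * Real.exp (-C)
  have h1 : Real.exp (-1) < 1 := by
    rw [Real.exp_lt_one_iff]; norm_num
  have h2 : Real.exp (-C) ≤ 1 := Real.exp_le_one_iff.2 (neg_nonpos.2 C.coe_nonneg)
  have hc0 : 0 ≤ c := by
    have := Real.exp_pos (-1)
    have := Real.exp_pos (-C)
    have : (1 - Real.exp (-1)) * Real.exp (-C) ≤ 1 * 1 :=
      mul_le_mul (by linarith) h2 (by positivity) zero_le_one
    linarith
  have hc1 : c < 1 := sub_lt_self _ (mul_pos (sub_pos.2 h1) (Real.exp_pos _))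
  have hae : ∀ n, AEMeasurable (fun ω => Real.exp (-T n ω)) μ := fun n =>
    (Real.measurable_exp.comp measurable_coe_nnreal_real.neg).comp_aemeasurable
      (hX.aemeasurable_time n)
  have hb : ∀ n ω, |Real.exp (-T n ω)| ≤ 1 := fun n ω => by
    rw [abs_of_pos (Real.exp_pos _)]
    exact Real.exp_le_one_iff.2 (neg_nonpos.2 (NNReal.coe_nonneg _))
  have hint : ∀ n, Integrable (fun ω => Real.exp (-T n ω)) μ := fun n =>
    integrable_of_bounded (hae n).aestronglyMeasurable (hb n)
  have hle : ∀ n, ∫ ω, Real.exp (-T n ω) ∂μ ≤ c ^ n := fun n => by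
    induction n with
    | zero =>
      refine (integral_mono (hint 0) (integrable_const 1) fun ω =>
        (le_abs_self _).trans (hb 0 ω)).trans ?_
      simp
    | succ n ih =>
      refine (hX.integral_exp_neg_time_succ_le hlam hC n).trans ?_
      rw [pow_succ']
      exact mul_le_mul_of_nonneg_left ih hc0
  -- The series of the `exp(-T_n)` has mean dominated by a geometric series, so it is almost surely
  -- finite and its terms tend to 0.
  have hsum : ∫⁻ ω, ∑' n, ENNReal.ofReal (Real.exp (-T n ω)) ∂μ ≠ ∞ := by
    rw [lintegral_tsum fun n => (hae n).ennreal_ofReal]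
    refine ne_top_of_le_ne_top
      (summable_geometric_of_lt_one hc0 hc1).tsum_ofReal_ne_top (ENNReal.tsum_le_tsum fun n => ?_)
    rw [← ofReal_integral_eq_lintegral_ofReal (hint n)
      (Eventually.of_forall fun ω => (Real.exp_pos _).le)]
    exact ENNReal.ofReal_le_ofReal (hle n)
  filter_upwards [ae_lt_top' (AEMeasurable.tsum fun n => (hae n).ennreal_ofReal) hsum]
    with ω hω t
  have ht := ENNReal.tendsto_atTop_zero_of_tsum_ne_top hω.ne
  obtain ⟨n, hn⟩ := (ht.eventually_lt_const
    (ENNReal.ofReal_pos.2 (Real.exp_pos (-(t : ℝ))))).exists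
  refine ⟨n, ?_⟩
  rw [ENNReal.ofReal_lt_ofReal_iff (Real.exp_pos _), Real.exp_lt_exp] at hn
  exact_mod_cast neg_lt_neg_iff.1 hn

theorem ae_eventually_lt_time [IsMarkovKernel Q] [IsProbabilityMeasure μ]
    (hX : IsConstruction P lam Q ζ Y T X μ) (hlam : Measurable lam) {C : ℝ≥0}
    (hC : ∀ p, lam p ≤ C) : ∀ᵐ ω ∂μ, ∀ t, ∀ᶠ n in atTop, t < T n ω := by
  filter_upwards [hX.ae_exists_lt_time hlam hC, hX.time_mono] with ω h1 h2 t
  obtain ⟨n, hn⟩ := h1 t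
  filter_upwards [eventually_ge_atTop n] with m hm
  exact hn.trans_le (h2 hm)

end IsConstruction

/-! ### Measurability of the process and the functionals stopped at switchings. -/

/-- The process following the path `ζ n` from time `T n` on, with the switchings after the
`N`-th one suppressed. -/
noncomputable def truncatedProcess (ζ : ℕ → Ω → Path d) (T : ℕ → Ω → ℝ≥0) : ℕ → ℝ≥0 → Ω → State d
  | 0, r, ω => ζ 0 ω (r - T 0 ω)
  | N + 1, r, ω => if T (N + 1) ω ≤ r then ζ (N + 1) ω (r - T (N + 1) ω)
      else truncatedProcess ζ T N r ω

/-- The value of `g` at the `n`-th switching or at time `t`, minus the integral of `h` along `X`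
up to then. -/
noncomputable def stoppedFunctional (g h : ℝ≥0 × State d → ℝ)
    (Y : ℕ → Ω → State d) (T : ℕ → Ω → ℝ≥0) (X : ℝ≥0 → Ω → State d) (t : ℝ≥0) (n : ℕ) (ω : Ω) :
    ℝ :=
  (if T n ω ≤ t then g (T n ω, Y n ω) else g (t, X t ω)) -
    ∫ r in Set.Iic t, (if r < T n ω then h (r, X r ω) else 0) ∂timeMeasure

theorem abs_stoppedFunctional_le {Ω : Type*} {Y : ℕ → Ω → State d} {T : ℕ → Ω → ℝ≥0}
    {X : ℝ≥0 → Ω → State d} {g h : ℝ≥0 × State d → ℝ} {D E : ℝ} (hgD : ∀ p, |g p| ≤ D)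
    (hhE : ∀ p, |h p| ≤ E) (t : ℝ≥0) (n : ℕ) (ω : Ω) :
    |stoppedFunctional g h Y T X t n ω| ≤ D + E * t := by
  refine (abs_sub _ _).trans (add_le_add ?_ ?_)
  · split_ifs <;> exact hgD _
  · exact abs_setIntegral_timeMeasure_le (fun w => abs_ite_zero_le (hhE _)) t

namespace IsConstruction

/-- Measurability of `X`, jointly in time and randomness. -/
theorem aemeasurable_process [IsMarkovKernel Q] [IsProbabilityMeasure μ]
    (hX : IsConstruction P lam Q ζ Y T X μ) (hlam : Measurable lam) {C : ℝ≥0}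
    (hC : ∀ p, lam p ≤ C) {α : Type*} [MeasurableSpace α] {m : Measure α} {ρ : α → ℝ≥0}
    (hρ : Measurable ρ) {π : α → Ω} (hπ : Measure.QuasiMeasurePreserving π m μ) :
    AEMeasurable (fun x => X (ρ x) (π x)) m := by
  -- The maps `ρ` and `π` cover both a fixed time and joint measurability in time and randomness;
  -- quasi-preservation carries null sets of `μ` back to `m`.
  have hζ : ∀ n, AEMeasurable (fun x => ζ n (π x)) m := fun n =>
    (hX.aemeasurable_path n).comp_quasiMeasurePreserving hπ
  have hT : ∀ n, AEMeasurable (fun x => T n (π x)) m := fun n =>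
    (hX.aemeasurable_time n).comp_quasiMeasurePreserving hπ
  have hζT : ∀ n, AEMeasurable (fun x => ζ n (π x) (ρ x - T n (π x))) m := fun n =>
    measurable_eval.comp_aemeasurable ((hζ n).prodMk (hρ.aemeasurable.sub (hT n)))
  have happ : ∀ N, AEMeasurable (fun x => truncatedProcess ζ T N (ρ x) (π x)) m := fun N => by
    induction N with
    | zero => exact hζT 0
    | succ N ih =>
      have hite : Measurable fun q : (ℝ≥0 × ℝ≥0) × State d × State d =>
          if q.1.1 ≤ q.1.2 then q.2.1 else q.2.2 :=
        Measurable.ite (measurableSet_le measurable_fst.fst measurable_fst.snd)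
          measurable_snd.fst measurable_snd.snd
      exact hite.comp_aemeasurable
        (((hT (N + 1)).prodMk hρ.aemeasurable).prodMk ((hζT (N + 1)).prodMk ih))
  refine aemeasurable_of_tendsto_metrizable_ae atTop happ ?_
  filter_upwards [hπ.ae hX.between, hπ.ae (hX.ae_eventually_lt_time hlam hC), hπ.ae hX.time_zero]
    with x hb ht h0
  -- Truncation is invisible before the next switching, so by non-accumulation the approximations
  -- are eventually constant.
  have heq : ∀ N, ρ x < T (N + 1) (π x) →
      truncatedProcess ζ T N (ρ x) (π x) = X (ρ x) (π x) := fun N hN => by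
    induction N with
    | zero => exact (hb 0 _ (h0 ▸ zero_le) hN).symm
    | succ N ih =>
      unfold truncatedProcess
      split_ifs with h
      · exact (hb (N + 1) _ h hN).symm
      · exact ih (not_le.1 h)
  refine tendsto_const_nhds.congr' ?_
  filter_upwards [(tendsto_add_atTop_nat 1).eventually (ht (ρ x))] with N hN
  exact (heq N hN).symm

theorem integrable_joint [IsMarkovKernel Q] [IsProbabilityMeasure μ]
    (hX : IsConstruction P lam Q ζ Y T X μ) (hlam : Measurable lam) {C : ℝ≥0}
    (hC : ∀ p, lam p ≤ C) {h : ℝ≥0 × State d → ℝ} (hh : Measurable h) {E : ℝ}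
    (hhE : ∀ p, |h p| ≤ E) (t : ℝ≥0) :
    Integrable (fun q : Ω × ℝ≥0 => h (q.2, X q.2 q.1))
      (μ.prod (timeMeasure.restrict (Set.Iic t))) :=
  integrable_of_bounded (hh.comp_aemeasurable (measurable_snd.aemeasurable.prodMk
    (hX.aemeasurable_process hlam hC measurable_snd
      Measure.quasiMeasurePreserving_fst))).aestronglyMeasurable fun _ => hhE _

theorem integrable_joint_lt_time [IsMarkovKernel Q] [IsProbabilityMeasure μ]
    (hX : IsConstruction P lam Q ζ Y T X μ) (hlam : Measurable lam) {C : ℝ≥0}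
    (hC : ∀ p, lam p ≤ C) {h : ℝ≥0 × State d → ℝ} (hh : Measurable h) {E : ℝ}
    (hhE : ∀ p, |h p| ≤ E) (t : ℝ≥0) (n : ℕ) :
    Integrable (fun q : Ω × ℝ≥0 => if q.2 < T n q.1 then h (q.2, X q.2 q.1) else 0)
      (μ.prod (timeMeasure.restrict (Set.Iic t))) := by
  have hite : Measurable fun q : (ℝ≥0 × ℝ≥0) × ℝ => if q.1.1 < q.1.2 then q.2 else 0 :=
    Measurable.ite (measurableSet_lt measurable_fst.fst measurable_fst.snd)
      measurable_snd measurable_const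
  refine integrable_of_bounded (hite.comp_aemeasurable ((measurable_snd.aemeasurable.prodMk
    ((hX.aemeasurable_time n).comp_quasiMeasurePreserving
      Measure.quasiMeasurePreserving_fst)).prodMk
    (hX.integrable_joint hlam hC hh hhE t).aestronglyMeasurable.aemeasurable)).aestronglyMeasurable
    fun _ => abs_ite_zero_le (hhE _)

theorem integrable_stoppedFunctional [IsMarkovKernel Q] [IsProbabilityMeasure μ]
    (hX : IsConstruction P lam Q ζ Y T X μ) (hlam : Measurable lam) {C : ℝ≥0}
    (hC : ∀ p, lam p ≤ C) {g h : ℝ≥0 × State d → ℝ} (hg : Measurable g) (hh : Measurable h)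
    {D E : ℝ} (hgD : ∀ p, |g p| ≤ D) (hhE : ∀ p, |h p| ≤ E) (t : ℝ≥0) (n : ℕ) :
    Integrable (stoppedFunctional g h Y T X t n) μ := by
  refine integrable_of_bounded (AEStronglyMeasurable.sub ?_ ?_)
    fun ω => abs_stoppedFunctional_le hgD hhE t n ω
  · have hite : Measurable fun q : (State d × ℝ≥0) × State d =>
        if q.1.2 ≤ t then g (q.1.2, q.1.1) else g (t, q.2) :=
      Measurable.ite (measurableSet_le measurable_fst.snd measurable_const)
        (hg.comp (measurable_fst.snd.prodMk measurable_fst.fst))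
        (hg.comp (measurable_const.prodMk measurable_snd))
    exact (hite.comp_aemeasurable ((hX.aemeasurable_switch n).prodMk
      (hX.aemeasurable_process hlam hC measurable_const
        (Measure.QuasiMeasurePreserving.id μ)))).aestronglyMeasurable
  · exact (hX.integrable_joint_lt_time hlam hC hh hhE t n).aestronglyMeasurable.integral_prod_right'

/-- The increment is the stretch from `T n` to `T (n+1)` seen up to `t`; it is zero once `T n`
exceeds `t`. -/
theorem ae_stoppedFunctional_succ [IsMarkovKernel Q] [IsProbabilityMeasure μ]
    (hX : IsConstruction P lam Q ζ Y T X μ) (hlam : Measurable lam) {C : ℝ≥0}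
    (hC : ∀ p, lam p ≤ C) (g : ℝ≥0 × State d → ℝ) {h : ℝ≥0 × State d → ℝ} (hh : Measurable h)
    {E : ℝ} (hhE : ∀ p, |h p| ≤ E) (t : ℝ≥0) (n : ℕ) :
    ∀ᵐ ω ∂μ, stoppedFunctional g h Y T X t (n + 1) ω = stoppedFunctional g h Y T X t n ω +
      ((if T n ω ≤ t then stepFunctional g h (T n ω) (ζ n ω) (t - T n ω)
          (Y (n + 1) ω, T (n + 1) ω - T n ω) else 0) -
        if T n ω ≤ t then g (T n ω, Y n ω) else 0) := by
  filter_upwards [hX.time_mono, hX.between,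
    (hX.integrable_joint_lt_time hlam hC hh hhE t n).prod_right_ae,
    (hX.integrable_joint_lt_time hlam hC hh hhE t (n + 1)).prod_right_ae] with ω hm hb hi hi'
  have hle : T n ω ≤ T (n + 1) ω := hm n.le_succ
  by_cases ht : T n ω ≤ t
  -- Subtraction here is truncated; `T n ≤ t` makes the elapsed-time comparison equivalent to `T
  -- (n+1) ≤ t`.
  · have hval : (if T (n + 1) ω - T n ω ≤ t - T n ω then
          g (T n ω + (T (n + 1) ω - T n ω), Y (n + 1) ω) else
          g (T n ω + (t - T n ω), ζ n ω (t - T n ω))) =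
        if T (n + 1) ω ≤ t then g (T (n + 1) ω, Y (n + 1) ω) else g (t, X t ω) := by
      rw [add_tsub_cancel_of_le hle, add_tsub_cancel_of_le ht]
      by_cases h1 : T (n + 1) ω ≤ t
      · simp [h1, tsub_le_tsub_right h1]
      · have h2 : ¬ T (n + 1) ω - T n ω ≤ t - T n ω := fun h => h1 (by
          simpa [add_tsub_cancel_of_le hle, add_tsub_cancel_of_le ht] using
            add_le_add_right h (T n ω))
        rw [if_neg h1, if_neg h2, hb n t ht (not_le.1 h1)]
    have hint : ∫ w in Set.Iic (t - T n ω), (if w < T (n + 1) ω - T n ω then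
          h (T n ω + w, ζ n ω w) else 0) ∂timeMeasure =
        (∫ r in Set.Iic t, (if r < T (n + 1) ω then h (r, X r ω) else 0) ∂timeMeasure) -
          ∫ r in Set.Iic t, (if r < T n ω then h (r, X r ω) else 0) ∂timeMeasure := by
      rw [← integral_sub hi' hi]
      have h1 : ∀ w, (if w < T (n + 1) ω - T n ω then h (T n ω + w, ζ n ω w) else 0) =
          (fun r => if r < T (n + 1) ω then h (r, X r ω) else 0) (T n ω + w) := fun w => by
        by_cases hw : T n ω + w < T (n + 1) ω
        · have := hb n (T n ω + w) (le_self_add) hw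
          rw [add_tsub_cancel_left] at this
          simp [lt_tsub_iff_left.2 hw, hw, this]
        · have hw' : ¬ w < T (n + 1) ω - T n ω := fun h => hw (lt_tsub_iff_left.1 h)
          simp [hw, hw']
      rw [integral_congr_ae (Eventually.of_forall h1), setIntegral_add_timeMeasure
        (fun r => if r < T (n + 1) ω then h (r, X r ω) else 0) ht]
      congr 1 with r
      by_cases hr : T n ω ≤ r
      · simp [hr, not_lt.2 hr]
      · have hr1 := not_le.1 hr
        simp [hr, hr1, hr1.trans_le hle]
    simp only [ht, if_true, stoppedFunctional]
    rw [show stepFunctional g h (T n ω) (ζ n ω) (t - T n ω) (Y (n + 1) ω, T (n + 1) ω - T n ω) =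
      _ from congrArg₂ (· - ·) hval hint]
    ring
  · have ht' : ¬ T (n + 1) ω ≤ t := fun h => ht (hle.trans h)
    have hint : ∀ k, t < T k ω →
        ∫ r in Set.Iic t, (if r < T k ω then h (r, X r ω) else 0) ∂timeMeasure =
          ∫ r in Set.Iic t, h (r, X r ω) ∂timeMeasure := fun k hk =>
      setIntegral_congr_fun measurableSet_Iic fun r hr => if_pos (lt_of_le_of_lt hr hk)
    simp only [stoppedFunctional, ht, ht', if_false, hint _ (not_le.1 ht), hint _ (not_le.1 ht')]
    ring

/-- The martingale identity is asked for only up to the horizon `t`, since it will be applied to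
functions cut off after `t`. -/
theorem integral_eq_of_bounded [IsMarkovKernel P] [IsMarkovKernel Q] [IsProbabilityMeasure μ]
    (hX : IsConstruction P lam Q ζ Y T X μ) (hP : ∀ s x, ∀ᵐ ω ∂(P (s, x)), ω 0 = x)
    (hlam : Measurable lam) {C : ℝ≥0} (hC : ∀ p, lam p ≤ C)
    {g a : ℝ≥0 × State d → ℝ} (hg : Measurable g) (ha : Measurable a) {D E : ℝ}
    (hgD : ∀ p, |g p| ≤ D) (haE : ∀ p, |a p| ≤ E) (t : ℝ≥0)
    (hmart : ∀ s x u, s + u = t → ∀ w ≤ u,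
      (P (s, x))[compensated g a s u | pathFiltration d w] =ᵐ[P (s, x)] compensated g a s w) :
    ∫ ω, g (t, X t ω) ∂μ = ∫ ω, g (0, Y 0 ω) ∂μ +
      ∫ r in Set.Iic t, ∫ ω, withSwitching lam Q g a (r, X r ω) ∂μ ∂timeMeasure := by
  have hh := measurable_withSwitching hlam Q hg ha
  have hhB := abs_withSwitching_le hC Q hgD haE
  have hstep := fun n => integral_stepFunctional hP hlam hC Q hg ha hgD haE t hmart
    (hX.hasCondDistrib_path n) (hX.hasCondDistrib_switch n)
  set h := withSwitching lam Q g a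
  set B := E + C * (2 * D)
  have hB0 : 0 ≤ B := (abs_nonneg _).trans (hhB (0, 0))
  set W := stoppedFunctional g h Y T X t
  have hWi : ∀ n, Integrable (W n) μ := hX.integrable_stoppedFunctional hlam hC hg hh hgD hhB t
  have hconst : ∀ n, ∫ ω, W n ω ∂μ = ∫ ω, g (0, Y 0 ω) ∂μ := fun n => by
    induction n with
    | zero =>
      -- With `T 0 = 0`, the value term is `g (0, Y 0)` and the running integral is over the empty
      -- range `r < 0`.
      refine integral_congr_ae ?_
      filter_upwards [hX.time_zero] with ω hω
      simp [W, stoppedFunctional, hω]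
    | succ n ih =>
      have hi1 : Integrable (fun ω => if T n ω ≤ t then stepFunctional g h (T n ω) (ζ n ω)
          (t - T n ω) (Y (n + 1) ω, T (n + 1) ω - T n ω) else 0) μ := by
        have hm : Measurable fun q : (ℝ≥0 × Path d) × (State d × ℝ≥0) =>
            if q.1.1 ≤ t then stepFunctional g h q.1.1 q.1.2 (t - q.1.1) q.2 else 0 :=
          Measurable.ite (measurableSet_le measurable_fst.fst measurable_const)
            ((measurable_stepFunctional hg hh).comp ((measurable_fst.prodMk
              (measurable_const.sub measurable_fst.fst)).prodMk measurable_snd))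
            measurable_const
        refine integrable_of_bounded (C := D + B * t) (hm.comp_aemeasurable
          (hX.hasCondDistrib_switch n).aemeasurable).aestronglyMeasurable fun ω =>
          abs_ite_zero_le ((abs_stepFunctional_le hgD hhB _ _ _ _).trans (add_le_add le_rfl
            (mul_le_mul_of_nonneg_left (NNReal.coe_le_coe.2 tsub_le_self) hB0)))
      have hi2 : Integrable (fun ω => if T n ω ≤ t then g (T n ω, Y n ω) else 0) μ := by
        have hm : Measurable fun q : State d × ℝ≥0 => if q.2 ≤ t then g (q.2, q.1) else 0 :=
          Measurable.ite (measurableSet_le measurable_snd measurable_const)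
            (hg.comp measurable_swap) measurable_const
        exact integrable_of_bounded (hm.comp_aemeasurable
          (hX.aemeasurable_switch n)).aestronglyMeasurable fun ω => abs_ite_zero_le (hgD _)
      rw [integral_congr_ae (hX.ae_stoppedFunctional_succ hlam hC g hh hhB t n),
        integral_add (hWi n) (show Integrable (fun ω => _ - _) μ from hi1.sub hi2),
        integral_sub hi1 hi2, hstep n, sub_self, add_zero]
      exact ih
  -- Once `T n` exceeds `t`, `W n` equals the limit exactly, and all `W n` share the bound `D + B *
  -- t`.
  have hlim : Tendsto (fun n => ∫ ω, W n ω ∂μ) atTop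
      (𝓝 (∫ ω, (g (t, X t ω) - ∫ r in Set.Iic t, h (r, X r ω) ∂timeMeasure) ∂μ)) := by
    refine tendsto_integral_of_dominated_convergence (fun _ => D + B * t)
      (fun n => (hWi n).aestronglyMeasurable) (integrable_const _)
      (fun n => Eventually.of_forall fun ω => abs_stoppedFunctional_le hgD hhB t n ω) ?_
    filter_upwards [hX.ae_eventually_lt_time hlam hC] with ω hω
    refine tendsto_const_nhds.congr' ?_
    filter_upwards [hω t] with n hn
    simp only [W, stoppedFunctional, not_le.2 hn, if_false]
    congr 1
    exact setIntegral_congr_fun measurableSet_Iic fun r hr => (if_pos (lt_of_le_of_lt hr hn)).symm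
  have hj := hX.integrable_joint hlam hC hh hhB t
  have hgi : Integrable (fun ω => g (t, X t ω)) μ :=
    integrable_of_bounded ((hg.comp measurable_prodMk_left).comp_aemeasurable
      (hX.aemeasurable_process hlam hC measurable_const
        (Measure.QuasiMeasurePreserving.id μ))).aestronglyMeasurable fun ω => hgD _
  have hhi : Integrable (fun ω => ∫ r in Set.Iic t, h (r, X r ω) ∂timeMeasure) μ :=
    hj.integral_prod_left
  simp_rw [hconst] at hlim
  have := tendsto_nhds_unique hlim tendsto_const_nhds
  rw [integral_sub hgi hhi, integral_integral_swap hj] at this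
  linarith

end IsConstruction

/-! ### From bounded functions to functions bounded on strips. -/

/-- The function equal to `f` up to time `t` and to `0` afterwards. -/
noncomputable def timeTruncation (t : ℝ≥0) (f : ℝ≥0 × State d → ℝ) (p : ℝ≥0 × State d) : ℝ :=
  if p.1 ≤ t then f p else 0

theorem measurable_timeTruncation (t : ℝ≥0) {f : ℝ≥0 × State d → ℝ} (hf : Measurable f) :
    Measurable (timeTruncation t f) :=
  Measurable.ite (measurableSet_le measurable_fst measurable_const) hf measurable_const

theorem timeTruncation_of_le {t : ℝ≥0} (f : ℝ≥0 × State d → ℝ) {p : ℝ≥0 × State d}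
    (h : p.1 ≤ t) : timeTruncation t f p = f p := if_pos h

theorem BoundedOnStrips.exists_abs_timeTruncation_le {f : ℝ≥0 × State d → ℝ}
    (hf : BoundedOnStrips f) (t : ℝ≥0) : ∃ D, ∀ p, |timeTruncation t f p| ≤ D := by
  obtain ⟨D, hD⟩ := hf t
  refine ⟨D, fun p => ?_⟩
  unfold timeTruncation
  split_ifs with h
  · exact hD p.1 h p.2
  · simpa using (abs_nonneg _).trans (hD 0 zero_le 0)

theorem withSwitching_timeTruncation (lam : ℝ≥0 × State d → ℝ≥0)
    (Q : Kernel (ℝ≥0 × State d) (State d)) (g a : ℝ≥0 × State d → ℝ) {t : ℝ≥0}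
    {p : ℝ≥0 × State d} (h : p.1 ≤ t) :
    withSwitching lam Q (timeTruncation t g) (timeTruncation t a) p = withSwitching lam Q g a p := by
  simp [withSwitching, timeTruncation, h]

theorem compensated_timeTruncation (g a : ℝ≥0 × State d → ℝ) {s w t : ℝ≥0} (h : s + w ≤ t) :
    compensated (timeTruncation t g) (timeTruncation t a) s w = compensated g a s w := by
  ext ω
  have hs : s ≤ t := le_self_add.trans h
  unfold compensated
  rw [timeTruncation_of_le g h, timeTruncation_of_le g hs]
  congr 1
  exact setIntegral_congr_fun measurableSet_Iic fun v hv =>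
    timeTruncation_of_le a ((add_le_add le_rfl hv).trans h)

/-- Every term, including the switching part of the generator, reads the functions only at times up
to `t`, so the cut-off changes nothing. -/
theorem IsConstruction.integral_eq [IsMarkovKernel P] [IsMarkovKernel Q] [IsProbabilityMeasure μ]
    (hX : IsConstruction P lam Q ζ Y T X μ) (hP : ∀ s x, ∀ᵐ ω ∂(P (s, x)), ω 0 = x)
    (hlam : Measurable lam) {C : ℝ≥0} (hC : ∀ p, lam p ≤ C)
    {g a : ℝ≥0 × State d → ℝ} (hg : Measurable g) (ha : Measurable a)
    (hgD : BoundedOnStrips g) (haE : BoundedOnStrips a)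
    (hmart : ∀ s x, Martingale (compensated g a s) (pathFiltration d) (P (s, x))) (t : ℝ≥0) :
    ∫ ω, g (t, X t ω) ∂μ = ∫ ω, g (0, Y 0 ω) ∂μ +
      ∫ r in Set.Iic t, ∫ ω, withSwitching lam Q g a (r, X r ω) ∂μ ∂timeMeasure := by
  obtain ⟨D, hD⟩ := hgD.exists_abs_timeTruncation_le t
  obtain ⟨E, hE⟩ := haE.exists_abs_timeTruncation_le t
  have h := hX.integral_eq_of_bounded hP hlam hC (measurable_timeTruncation t hg)
    (measurable_timeTruncation t ha) hD hE t fun s x u hsu w hw => by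
      rw [compensated_timeTruncation g a hsu.le,
        compensated_timeTruncation g a ((add_le_add le_rfl hw).trans hsu.le)]
      exact (hmart s x).condExp_ae_eq hw
  have h0 : ∀ x : State d, timeTruncation t g (0, x) = g (0, x) := fun x =>
    timeTruncation_of_le g zero_le
  have ht : ∀ x : State d, timeTruncation t g (t, x) = g (t, x) := fun x =>
    timeTruncation_of_le g le_rfl
  simp only [h0, ht] at h
  rw [h]
  congr 1
  refine setIntegral_congr_fun measurableSet_Iic fun r hr => ?_
  simp only [withSwitching_timeTruncation lam Q g a (p := (r, _)) (Set.mem_Iic.1 hr)]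

end Switching

/-! ### The main theorem. -/

theorem mainTheorem6 {d : ℕ}
    -- laws of the intrinsic process started at time `s` from `x`, for every `(s, x)`
    (P : Kernel (ℝ≥0 × Switching.State d) (Switching.Path d)) [IsMarkovKernel P]
    (hP : ∀ s x, ∀ᵐ ω ∂(P (s, x)), ω 0 = x)
    -- the bounded switching rate and the switching kernel
    (lam : ℝ≥0 × Switching.State d → ℝ≥0) (hlam : Measurable lam)
    (hlam_bdd : ∃ C : ℝ≥0, ∀ p, lam p ≤ C)
    (Q : Kernel (ℝ≥0 × Switching.State d) (Switching.State d)) [IsMarkovKernel Q]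
    -- the operator `(𝒟, A₀)`
    (𝒟 : Set (ℝ≥0 × Switching.State d → ℝ))
    (A₀ : 𝒟 → (ℝ≥0 × Switching.State d → ℝ))
    (h𝒟_meas : ∀ g : 𝒟, Measurable (g : ℝ≥0 × Switching.State d → ℝ))
    (h𝒟_bdd : ∀ g : 𝒟, Switching.BoundedOnStrips (g : ℝ≥0 × Switching.State d → ℝ))
    (hA₀_meas : ∀ g : 𝒟, Measurable (A₀ g))
    (hA₀_bdd : ∀ g : 𝒟, Switching.BoundedOnStrips (A₀ g))
    (hmart : ∀ g : 𝒟, ∀ s x,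
      Martingale (Switching.compensated (g : ℝ≥0 × Switching.State d → ℝ) (A₀ g) s)
        (Switching.pathFiltration d) (P (s, x)))
    -- the switching process
    {Ω : Type*} [MeasurableSpace Ω] (μ : Measure Ω) [IsProbabilityMeasure μ]
    (X : ℝ≥0 → Ω → Switching.State d)
    (hX : Switching.IsInhomogeneousSP P lam Q X μ)
    (g : 𝒟) (t : ℝ≥0) :
    Integrable (fun ω => g.1 (t, X t ω)) μ ∧
    (∀ s, Integrable
      (fun ω => Switching.withSwitching lam Q g.1 (A₀ g) (s, X s ω)) μ) ∧
    IntegrableOn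
      (fun s => ∫ ω, Switching.withSwitching lam Q g.1 (A₀ g) (s, X s ω) ∂μ)
      (Set.Iic t) Switching.timeMeasure ∧
    ∫ ω, g.1 (t, X t ω) ∂μ = ∫ ω, g.1 (0, X 0 ω) ∂μ +
      ∫ s in Set.Iic t,
        (∫ ω, Switching.withSwitching lam Q g.1 (A₀ g) (s, X s ω) ∂μ)
        ∂Switching.timeMeasure := by
  open Switching in
  obtain ⟨C, hC⟩ := hlam_bdd
  obtain ⟨ζ, Y, T, hX⟩ := hX
  have hXm : ∀ s, AEMeasurable (X s) μ := fun s =>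
    hX.aemeasurable_process hlam hC measurable_const (Measure.QuasiMeasurePreserving.id μ)
  have hform := hX.integral_eq hP hlam hC (h𝒟_meas g) (hA₀_meas g) (h𝒟_bdd g) (hA₀_bdd g) (hmart g)
  -- Up to any time `s`, `Ã₀ g` agrees with a bounded measurable function, which gives the
  -- integrability claims.
  have htrunc : ∀ s, ∃ h : ℝ≥0 × State d → ℝ, Measurable h ∧ (∃ B, ∀ p, |h p| ≤ B) ∧
      ∀ r ≤ s, ∀ x, withSwitching lam Q g.1 (A₀ g) (r, x) = h (r, x) := fun s => by
    obtain ⟨D, hD⟩ := (h𝒟_bdd g).exists_abs_timeTruncation_le s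
    obtain ⟨E, hE⟩ := (hA₀_bdd g).exists_abs_timeTruncation_le s
    exact ⟨_, measurable_withSwitching hlam Q (measurable_timeTruncation s (h𝒟_meas g))
      (measurable_timeTruncation s (hA₀_meas g)), ⟨_, abs_withSwitching_le hC Q hD hE⟩,
      fun r hr x => (withSwitching_timeTruncation lam Q g.1 (A₀ g) hr).symm⟩
  refine ⟨?_, fun s => ?_, ?_, ?_⟩
  · obtain ⟨D, hD⟩ := h𝒟_bdd g t
    exact integrable_of_bounded (((h𝒟_meas g).comp measurable_prodMk_left).comp_aemeasurable
      (hXm t)).aestronglyMeasurable fun ω => hD t le_rfl _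
  · obtain ⟨h, hh, ⟨B, hB⟩, heq⟩ := htrunc s
    simp only [heq s le_rfl]
    exact integrable_of_bounded ((hh.comp measurable_prodMk_left).comp_aemeasurable
      (hXm s)).aestronglyMeasurable fun ω => hB _
  · obtain ⟨h, hh, ⟨B, hB⟩, heq⟩ := htrunc t
    have hj : IntegrableOn (fun r => ∫ ω, h (r, X r ω) ∂μ) (Set.Iic t) timeMeasure :=
      (hX.integrable_joint hlam hC hh hB t).integral_prod_right
    refine hj.congr_fun (fun r hr => ?_) measurableSet_Iic
    simp only [heq r hr]
  -- The formula so far starts from `Y 0`. At time 0 its integral is over a null set, so `g (0, X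
  -- 0)` and `g (0, Y 0)` have the same mean.
  · have h0 := hform 0
    have hIic : Set.Iic (0 : ℝ≥0) = {0} := by ext; simp
    rw [hIic, Measure.restrict_eq_zero.2 (measure_singleton 0), integral_zero_measure,
      add_zero] at h0
    rw [h0]
    exact hform t
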